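/- For a finite field $\mathbb{F}$, elements $a\ne b$ of $\mathbb{F}$ and a positive integer $n$, let $\mathrm{DET}_{a,b}^{\mathbb{F},n}$ be the partial two-party communication problem in which Alice holds $A\in\mathbb{F}^{n\times n}$, Bob holds $B\in\mathbb{F}^{n\times n}$, and $$\mathrm{DET}_{a,b}^{\mathbb{F},n}(A,B)=\begin{cases}-1&\text{if }\det(A+B)=a,\\ 1&\text{if }\det(A+B)=b,\\ *&\text{otherwise.}\end{cases}$$ For a partial function $F\colon X\times Y\to\{-1,1,*\}$ let $Q^*_\epsilon(F)$ be the $\epsilon$-error quantum communication complexity of $F$ with arbitrary prior entanglement, i.e. the least number of qubits exchanged by a two-party quantum protocol (with an arbitrary shared entangled initial state that does not depend on the inputs) that, on every input $(x,y)$ with $F(x,y)\neq *$, outputs $F(x,y)$ with probability at least $1-\epsilon$. Theorem. There is an absolute constant $c>0$ such that for every finite field $\mathbb{F}$, every pair of distinct elements $a,b\in\mathbb{F}$, and all integers $n\ge 2$, $$Q^{*}_{\frac12-\frac{1}{4|\mathbb{F}|^{(n-1)/3}}}\bigl(\mathrm{DET}_{a,b}^{\mathbb{F},n}\bigr)\;\ge\;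 c\,n^{2}\log_2|\mathbb{F}|.$$ -/

import Mathlib

open scoped Matrix

/-- An isometry between finite-dimensional Hilbert spaces with fixed orthonormal bases. -/
def IsIsometryMatrix {κ ι : Type} [Fintype κ] (V : Matrix κ ι ℂ) : Prop :=
  open Classical in Vᴴ * V = 1

/-- The label set of the computational basis of one qubit: the two basis states are labelled
by the two possible outputs `1` and `-1`. -/
abbrev QubitBasis : Type := ℤˣ

/-- The continuation of a two-party quantum protocol with input sets `X` (Alice) and `Y` (Bob),
at a moment where Alice holds a private register with finite basis `α` and Bob holds a private
register with finite basis `β`.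

* `aliceSend V next`: on input `x`, Alice applies the isometry `V x` to her register, which
  splits it into one qubit and a new private register `α'` (an isometry is a unitary after
  fresh ancillas are adjoined).  The qubit is sent to Bob, whose register becomes
  qubit ⊗ `β`, and the protocol goes on with `next`.
* `aliceOutput V`: on input `x`, Alice applies the isometry `V x` to her register and measures
  the resulting qubit in the computational basis; the outcome is the output of the protocol.
* `bobSend`, `bobOutput`: the same with the roles exchanged.

The order in which the players speak is fixed by the protocol; the operations of Alice depend
on `x` only, those of Bob on `y` only. -/
inductive QuantumSteps (X : Type*) (Y : Type*) : Type → Type → Type _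
  | aliceSend {α β α' : Type} [Fintype α']
      (V : X → Matrix (QubitBasis × α') α ℂ) (isometry : ∀ x, IsIsometryMatrix (V x))
      (next : QuantumSteps X Y α' (QubitBasis × β)) : QuantumSteps X Y α β
  | bobSend {α β β' : Type} [Fintype β']
      (W : Y → Matrix (QubitBasis × β') β ℂ) (isometry : ∀ y, IsIsometryMatrix (W y))
      (next : QuantumSteps X Y (QubitBasis × α) β') : QuantumSteps X Y α β
  | aliceOutput {α β α' : Type} [Fintype α']
      (V : X → Matrix (QubitBasis × α') α ℂ) (isometry : ∀ x, IsIsometryMatrix (V x)) :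
      QuantumSteps X Y α β
  | bobOutput {α β β' : Type} [Fintype β']
      (W : Y → Matrix (QubitBasis × β') β ℂ) (isometry : ∀ y, IsIsometryMatrix (W y)) :
      QuantumSteps X Y α β

namespace QuantumSteps

/-- The number of qubits that are sent. -/
def cost {X Y : Type*} {α β : Type} : QuantumSteps X Y α β → ℕ
  | aliceSend _ _ next => next.cost + 1
  | bobSend _ _ next => next.cost + 1
  | aliceOutput _ _ => 0
  | bobOutput _ _ => 0

/-- The probability that the output is `s` on input `(x, y)`, when the current joint pure state
is `∑ i j, ψ i j |i⟩|j⟩` (`i` indexes Alice's register and `j` Bob's).  On such amplitude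
matrices, an operator `V` of Alice acts as `V * ψ` and an operator `W` of Bob as `ψ * Wᵀ`. -/
noncomputable def outputProb {X Y : Type*} (x : X) (y : Y) (s : QubitBasis) {α β : Type}
    [Fintype α] [Fintype β] : QuantumSteps X Y α β → Matrix α β ℂ → ℝ
  | aliceSend V _ next, ψ =>
      next.outputProb x y s (Matrix.of fun i (sj : QubitBasis × β) => (V x * ψ) (sj.1, i) sj.2)
  | bobSend W _ next, ψ =>
      next.outputProb x y s
        (Matrix.of fun (si : QubitBasis × α) j => (ψ * (W y)ᵀ) si.2 (si.1, j))
  | aliceOutput (α' := α') V _, ψ => ∑ i : α', ∑ j : β, ‖(V x * ψ) (s, i) j‖ ^ 2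
  | bobOutput (β' := β') W _, ψ => ∑ i : α, ∑ j : β', ‖(ψ * (W y)ᵀ) i (s, j)‖ ^ 2

end QuantumSteps

/-- A two-party quantum communication protocol with arbitrary prior entanglement: before the
inputs are given, Alice and Bob share a pure state `∑ i j, initial i j |i⟩|j⟩` of two registers
of arbitrary finite dimension; then they follow `steps`.  Fresh ancillas, shared randomness and
shared mixed states (through a purification) are all covered by the choice of `initial`. -/
structure QuantumProtocol (X : Type*) (Y : Type*) where
  α : Type
  β : Type
  [fintypeAlice : Fintype α]
  [fintypeBob : Fintype β]
  initial : Matrix α β ℂ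
  initial_unit : ∑ i, ∑ j, ‖initial i j‖ ^ 2 = 1
  steps : QuantumSteps X Y α β

namespace QuantumProtocol

/-- The total number of qubits exchanged. -/
def cost {X Y : Type*} (P : QuantumProtocol X Y) : ℕ := P.steps.cost

/-- The probability that the protocol outputs `s` on input `(x, y)`. -/
noncomputable def outputProb {X Y : Type*} (P : QuantumProtocol X Y) (x : X) (y : Y)
    (s : ℤˣ) : ℝ :=
  letI := P.fintypeAlice
  letI := P.fintypeBob
  P.steps.outputProb x y s P.initial

/-- `P` is an `ε`-error protocol for the partial Boolean function `F : X × Y → {-1, 1, *}`,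
where `*` is `none`: on every input in the domain of `F`, the correct value is output with
probability at least `1 - ε`. -/
def HasError {X Y : Type*} (P : QuantumProtocol X Y) (F : X → Y → Option ℤˣ) (ε : ℝ) : Prop :=
  ∀ x y s, F x y = some s → 1 - ε ≤ P.outputProb x y s

end QuantumProtocol

/-- `Q*_ε(F)`: the least cost of an `ε`-error quantum protocol with arbitrary prior
entanglement for `F`. -/
noncomputable def quantumCC {X Y : Type*} (ε : ℝ) (F : X → Y → Option ℤˣ) : ℕ∞ :=
  ⨅ (P : QuantumProtocol X Y) (_ : P.HasError F ε), (P.cost : ℕ∞)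

/-- The determinant problem `DET_{a,b}^{𝔽,n}`. -/
noncomputable def detProblem {𝔽 : Type*} [Field 𝔽] (n : ℕ) (a b : 𝔽)
    (A B : Matrix (Fin n) (Fin n) 𝔽) : Option ℤˣ :=
  open Classical in
  if (A + B).det = a then some (-1) else if (A + B).det = b then some 1 else none

/-! The proof is a discrepancy argument on the Fourier side. Pulling the final measurement back
through a protocol of cost `C` writes its output probability as an inner product of vectors
depending on `x` and on `y` alone, each of squared norm at most `4 ^ C`, whatever the dimension of
the shared state (`exists_outputProb_eq_inner`). Since the problem depends only on `A + B`, it is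
tested against a signed weight `φ (A + B)`. Such a kernel is diagonalized by additive characters, so
the correlation is controlled by the largest Fourier coefficient of `φ` (`norm_sum_inner_mul_le`,
`QuantumProtocol.discrepancy_bound`).

It remains to find a weight of total sum zero, concentrated on the promise with the right signs,
whose Fourier coefficients are all tiny. Take `φ` invariant under determinant-one matrices on both
sides. Its transform is then constant on each set of singular matrices of a given rank and on each
nonzero determinant class. The coefficients of rank at most `m` vanish as soon as the moments of `φ`
against `q ^ (j * corank)`, `j ≤ m`, vanish (`IsSLInvariant.matrixFourier_eq_zero`). The others are
small by Plancherel, because each value is repeated over a huge orbit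
(`IsSLInvariant.norm_sq_matrixFourier_le`).

If `a` and `b` are both nonzero, the difference of the uniform measures on the two determinant
classes has all these moments zero. If one of them is zero, put masses on corank `0` (determinant
`t`), corank `1` and coranks `l` to `n`, given by the divided difference at the nodes `q ^ i`; it
annihilates polynomials of degree at most `n + 1 - l`. The masses at `0` and `1` have absolute value
between `1` and `4`, while the remaining ones total `O(q ^ (1 - l))`. Taking `l` slightly above `n /
3` puts this tail below the advantage of order `q ^ (-(n - 1) / 3)`, and still leaves squared
Fourier coefficients of size `q ^ (-Ω(n ^ 2))`. -/

/-! ### Contractions and expectations of product operators. -/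

/-- A matrix that does not increase the Euclidean norm. -/
def IsContractionMatrix {κ ι : Type*} [Fintype κ] [Fintype ι] (A : Matrix κ ι ℂ) : Prop :=
  ∀ v : ι → ℂ, ∑ i, ‖(A *ᵥ v) i‖ ^ 2 ≤ ∑ j, ‖v j‖ ^ 2

theorem ofReal_sum_norm_sq {ι : Type*} [Fintype ι] (v : ι → ℂ) :
    ((∑ i, ‖v i‖ ^ 2 : ℝ) : ℂ) = star v ⬝ᵥ v := by
  push_cast
  refine Finset.sum_congr rfl fun i _ => ?_
  simp only [Pi.star_apply, RCLike.star_def, Complex.conj_mul']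

namespace IsIsometryMatrix

theorem sum_norm_sq {κ ι : Type} [Fintype κ] [Fintype ι] {V : Matrix κ ι ℂ}
    (h : IsIsometryMatrix V) (v : ι → ℂ) : ∑ i, ‖(V *ᵥ v) i‖ ^ 2 = ∑ j, ‖v j‖ ^ 2 := by
  have h' : ((∑ i, ‖(V *ᵥ v) i‖ ^ 2 : ℝ) : ℂ) = ((∑ j, ‖v j‖ ^ 2 : ℝ) : ℂ) := by
    classical
    rw [ofReal_sum_norm_sq, ofReal_sum_norm_sq, Matrix.star_mulVec, ← Matrix.dotProduct_mulVec,
      Matrix.mulVec_mulVec]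
    have h1 : Vᴴ * V = 1 := by
      unfold IsIsometryMatrix at h
      convert h
    rw [h1, Matrix.one_mulVec]
  exact_mod_cast h'

theorem isContractionMatrix {κ ι : Type} [Fintype κ] [Fintype ι] {V : Matrix κ ι ℂ}
    (h : IsIsometryMatrix V) : IsContractionMatrix V := fun v => (h.sum_norm_sq v).le

theorem sum_norm_sq_mul {κ ι μ : Type} [Fintype κ] [Fintype ι] [Fintype μ] {V : Matrix κ ι ℂ}
    (h : IsIsometryMatrix V) (M : Matrix ι μ ℂ) :
    ∑ i, ∑ j, ‖(V * M) i j‖ ^ 2 = ∑ i, ∑ j, ‖M i j‖ ^ 2 := by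
  rw [Finset.sum_comm, Finset.sum_comm (γ := ι)]
  exact Finset.sum_congr rfl fun j _ => h.sum_norm_sq fun i => M i j

theorem sum_norm_sq_mul_transpose {κ ι μ : Type} [Fintype κ] [Fintype ι] [Fintype μ]
    {V : Matrix κ ι ℂ} (h : IsIsometryMatrix V) (M : Matrix μ ι ℂ) :
    ∑ i, ∑ j, ‖(M * Vᵀ) i j‖ ^ 2 = ∑ i, ∑ j, ‖M i j‖ ^ 2 := by
  have := h.sum_norm_sq_mul Mᵀ
  rw [Finset.sum_comm, Finset.sum_comm (γ := ι)] at this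
  simpa only [← Matrix.transpose_apply (M * Vᵀ), Matrix.transpose_mul, Matrix.transpose_transpose,
    Matrix.transpose_apply M] using this

end IsIsometryMatrix

namespace IsContractionMatrix

variable {κ ι μ : Type*} [Fintype κ] [Fintype ι] [Fintype μ]

theorem one [DecidableEq ι] : IsContractionMatrix (1 : Matrix ι ι ℂ) := fun v => by simp

theorem mul {A : Matrix κ ι ℂ} {B : Matrix ι μ ℂ} (hA : IsContractionMatrix A)
    (hB : IsContractionMatrix B) : IsContractionMatrix (A * B) := fun v => by
  rw [← Matrix.mulVec_mulVec]
  exact (hA _).trans (hB v)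

/-- With `v = Aᴴ w`, `‖v‖² = Re ⟨w, A v⟩ ≤ (‖w‖² + ‖A v‖²) / 2 ≤ (‖w‖² + ‖v‖²) / 2`, and `‖v‖²` is
absorbed on the left. -/
theorem conjTranspose {A : Matrix κ ι ℂ} (hA : IsContractionMatrix A) :
    IsContractionMatrix Aᴴ := fun w => by
  set v := Aᴴ *ᵥ w with hv
  have h1 : ((∑ i, ‖v i‖ ^ 2 : ℝ) : ℂ) = star w ⬝ᵥ (A *ᵥ v) := by
    rw [ofReal_sum_norm_sq, hv, Matrix.star_mulVec, Matrix.conjTranspose_conjTranspose,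
      Matrix.dotProduct_mulVec (star w)]
  have h2 : ∑ i, ‖v i‖ ^ 2 ≤ ∑ i, (‖w i‖ ^ 2 + ‖(A *ᵥ v) i‖ ^ 2) / 2 := by
    have h3 : ∑ i, ‖v i‖ ^ 2 = (star w ⬝ᵥ (A *ᵥ v)).re := by rw [← h1, Complex.ofReal_re]
    rw [h3]
    simp only [dotProduct, Complex.re_sum, Pi.star_apply]
    refine Finset.sum_le_sum fun i _ => ?_
    refine (Complex.re_le_norm _).trans ?_
    rw [norm_mul, norm_star]
    nlinarith [sq_nonneg (‖w i‖ - ‖(A *ᵥ v) i‖)]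
  have h4 := hA v
  rw [← Finset.sum_div, Finset.sum_add_distrib] at h2
  linarith

theorem submatrix_left {ι' : Type*} [Fintype ι'] {A : Matrix κ ι ℂ} (hA : IsContractionMatrix A)
    {e : ι' → κ} (he : Function.Injective e) : IsContractionMatrix (A.submatrix e id) := fun v => by
  refine le_trans ?_ (hA v)
  classical
  have : ∑ i, ‖(A.submatrix e id *ᵥ v) i‖ ^ 2 =
      ∑ k ∈ Finset.univ.image e, ‖(A *ᵥ v) k‖ ^ 2 := by
    rw [Finset.sum_image he.injOn]
    rfl
  rw [this]
  exact Finset.sum_le_sum_of_subset_of_nonneg (Finset.subset_univ _) fun _ _ _ => by positivity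

theorem submatrix {κ' ι' : Type*} [Fintype κ'] [Fintype ι'] {A : Matrix κ ι ℂ}
    (hA : IsContractionMatrix A) {e : κ' → κ} {f : ι' → ι} (he : Function.Injective e)
    (hf : Function.Injective f) : IsContractionMatrix (A.submatrix e f) := by
  have h := ((hA.submatrix_left he).conjTranspose.submatrix_left hf).conjTranspose
  have e : A.submatrix e f = ((A.submatrix e id)ᴴ.submatrix f id)ᴴ := by
    ext
    simp
  rwa [e]

theorem sum_norm_sq_mul_le {A : Matrix κ ι ℂ} (h : IsContractionMatrix A) (M : Matrix ι μ ℂ) :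
    ∑ i, ∑ j, ‖(A * M) i j‖ ^ 2 ≤ ∑ i, ∑ j, ‖M i j‖ ^ 2 := by
  rw [Finset.sum_comm, Finset.sum_comm (γ := ι)]
  exact Finset.sum_le_sum fun j _ => h fun i => M i j

theorem sum_norm_sq_mul_transpose_le {A : Matrix κ ι ℂ} (h : IsContractionMatrix A)
    (M : Matrix μ ι ℂ) :
    ∑ i, ∑ j, ‖(M * Aᵀ) i j‖ ^ 2 ≤ ∑ i, ∑ j, ‖M i j‖ ^ 2 := by
  have := h.sum_norm_sq_mul_le Mᵀ
  rw [Finset.sum_comm, Finset.sum_comm (γ := ι)] at this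
  simpa only [← Matrix.transpose_apply (M * Aᵀ), Matrix.transpose_mul, Matrix.transpose_transpose,
    Matrix.transpose_apply M] using this

end IsContractionMatrix

/-- The expectation `⟨ψ, (A ⊗ B) ψ⟩` of a product operator in a bipartite state. -/
noncomputable def productExpectation {α β : Type*} [Fintype α] [Fintype β] (A : Matrix α α ℂ)
    (B : Matrix β β ℂ) (ψ : Matrix α β ℂ) : ℂ :=
  ∑ i, ∑ j, star (ψ i j) * (A * ψ * Bᵀ) i j

theorem productExpectation_transpose {α β : Type*} [Fintype α] [Fintype β] (A : Matrix α α ℂ)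
    (B : Matrix β β ℂ) (ψ : Matrix α β ℂ) :
    productExpectation B A ψᵀ = productExpectation A B ψ := by
  unfold productExpectation
  rw [Finset.sum_comm]
  refine Finset.sum_congr rfl fun i _ => Finset.sum_congr rfl fun j _ => ?_
  have : B * ψᵀ * Aᵀ = (A * ψ * Bᵀ)ᵀ := by
    simp [Matrix.transpose_mul, Matrix.mul_assoc]
  rw [this]
  rfl

theorem sum_star_mul_eq_trace {α β : Type*} [Fintype α] [Fintype β] (M N : Matrix α β ℂ) :
    ∑ i, ∑ j, star (M i j) * N i j = (Mᴴ * N).trace := by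
  rw [Finset.sum_comm]
  rfl

theorem productExpectation_conj {α α' β : Type*} [Fintype α] [Fintype α'] [Fintype β]
    (K L : Matrix α' α ℂ) (A : Matrix α' α' ℂ) (B : Matrix β β ℂ) (ψ : Matrix α β ℂ) :
    productExpectation (Kᴴ * A * L) B ψ =
      ∑ i, ∑ j, star ((K * ψ) i j) * (A * (L * ψ) * Bᵀ) i j := by
  unfold productExpectation
  rw [sum_star_mul_eq_trace, sum_star_mul_eq_trace, Matrix.conjTranspose_mul]
  simp only [Matrix.mul_assoc]

/-- An operator on `σ ⊗ β` is cut into its `σ × σ` blocks. For a qubit `σ` there are four of them,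
which is where the factor `4` per message comes from. -/
theorem productExpectation_block {α' β σ : Type*} [Fintype α'] [Fintype β] [Fintype σ]
    (A : Matrix α' α' ℂ) (B : Matrix (σ × β) (σ × β) ℂ) (φ : σ → Matrix α' β ℂ) :
    productExpectation A B (Matrix.of fun i (sj : σ × β) => φ sj.1 i sj.2) =
      ∑ s, ∑ t, ∑ i, ∑ j, star (φ s i j) *
        (A * φ t * (B.submatrix (Prod.mk s) (Prod.mk t))ᵀ) i j := by
  unfold productExpectation
  have h : ∀ i s j, (A * (Matrix.of fun i (sj : σ × β) => φ sj.1 i sj.2) * Bᵀ) i (s, j) =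
      ∑ t, (A * φ t * (B.submatrix (Prod.mk s) (Prod.mk t))ᵀ) i j := by
    intro i s j
    rw [Matrix.mul_apply, Fintype.sum_prod_type]
    rfl
  simp only [Fintype.sum_prod_type, h, Finset.mul_sum, Matrix.of_apply]
  rw [Finset.sum_comm]
  refine Finset.sum_congr rfl fun s _ => ?_
  rw [Finset.sum_comm (γ := σ)]
  exact Finset.sum_congr rfl fun i _ => Finset.sum_comm

/-! ### Output probabilities and their factorization. -/

namespace QuantumSteps

variable {X Y : Type*}

theorem outputProb_nonneg (x : X) (y : Y) (s : ℤˣ) {α β : Type} (S : QuantumSteps X Y α β) :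
    ∀ [Fintype α] [Fintype β] (ψ : Matrix α β ℂ), 0 ≤ S.outputProb x y s ψ := by
  induction S with
  | aliceSend V h next ih => intros; exact ih _
  | bobSend V h next ih => intros; exact ih _
  | aliceOutput V h => intros; simp only [outputProb]; positivity
  | bobOutput V h => intros; simp only [outputProb]; positivity

theorem sum_outputProb (x : X) (y : Y) {α β : Type} (S : QuantumSteps X Y α β) :
    ∀ [Fintype α] [Fintype β] (ψ : Matrix α β ℂ),
      ∑ s : ℤˣ, S.outputProb x y s ψ = ∑ i, ∑ j, ‖ψ i j‖ ^ 2 := by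
  induction S with
  | aliceSend V h next ih =>
    intro _ _ ψ
    simp only [outputProb]
    rw [ih, ← (h x).sum_norm_sq_mul ψ]
    simp only [Fintype.sum_prod_type, Matrix.of_apply]
    rw [Finset.sum_comm]
  | bobSend V h next ih =>
    intro _ _ ψ
    simp only [outputProb]
    rw [ih, ← (h y).sum_norm_sq_mul_transpose ψ]
    simp only [Fintype.sum_prod_type, Matrix.of_apply]
    rw [Finset.sum_comm]
  | aliceOutput V h =>
    intro _ _ ψ
    simp only [outputProb]
    rw [← (h x).sum_norm_sq_mul ψ, Fintype.sum_prod_type]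
  | bobOutput V h =>
    intro _ _ ψ
    simp only [outputProb]
    rw [← (h y).sum_norm_sq_mul_transpose ψ, Finset.sum_comm]
    simp only [Fintype.sum_prod_type]

theorem outputProb_eq_of_cost_eq_zero {α β : Type} [Fintype α] [Fintype β]
    (S : QuantumSteps X Y α β) (hS : S.cost = 0) (s : ℤˣ) (ψ : Matrix α β ℂ) :
    (∀ x y y', S.outputProb x y s ψ = S.outputProb x y' s ψ) ∨
      (∀ x x' y, S.outputProb x y s ψ = S.outputProb x' y s ψ) := by
  cases S with
  | aliceSend V h next => simp [cost] at hS
  | bobSend V h next => simp [cost] at hS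
  | aliceOutput V h => exact Or.inl fun _ _ _ => rfl
  | bobOutput V h => exact Or.inr fun _ _ _ => rfl

/-- Heisenberg picture: the final projector, a single product operator, is pulled back step by step.
Undoing a message conjugates the sender's operators by blocks of the isometry and cuts the
receiver's into four blocks. Both operations preserve contractions. -/
theorem exists_outputProb_eq_sum_productExpectation (s : ℤˣ) {α β : Type}
    (S : QuantumSteps X Y α β) :
    ∀ [Fintype α] [Fintype β], ∃ (κ : Type) (_ : Fintype κ) (A : X → κ → Matrix α α ℂ)
      (B : Y → κ → Matrix β β ℂ), Fintype.card κ = 4 ^ S.cost ∧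
      (∀ x k, IsContractionMatrix (A x k)) ∧ (∀ y k, IsContractionMatrix (B y k)) ∧
      ∀ x y ψ, (S.outputProb x y s ψ : ℂ) = ∑ k, productExpectation (A x k) (B y k) ψ := by
  classical
  have hinj : ∀ {γ : Type} (t : ℤˣ), Function.Injective (Prod.mk t : γ → ℤˣ × γ) :=
    fun t _ _ h => (Prod.mk.inj h).2
  have hcard : Fintype.card (ℤˣ × ℤˣ) = 4 := by simp
  induction S with
  | @aliceSend α β α' _ V h next ih =>
    intro _ _
    obtain ⟨κ, _, A, B, hκ, hA, hB, hAB⟩ := ih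
    refine ⟨κ × (ℤˣ × ℤˣ), inferInstance,
      fun x k => ((V x).submatrix (Prod.mk k.2.1) id)ᴴ * A x k.1 *
        (V x).submatrix (Prod.mk k.2.2) id,
      fun y k => (B y k.1).submatrix (Prod.mk k.2.1) (Prod.mk k.2.2), ?_, ?_, ?_, ?_⟩
    · rw [Fintype.card_prod, hκ, hcard, cost, pow_succ]
    · intro x k
      have hV := (h x).isContractionMatrix
      exact ((hV.submatrix_left (hinj _)).conjTranspose.mul (hA _ _)).mul
        (hV.submatrix_left (hinj _))
    · exact fun y k => (hB _ _).submatrix (hinj _) (hinj _)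
    · intro x y ψ
      simp only [outputProb]
      rw [hAB, Fintype.sum_prod_type]
      refine Finset.sum_congr rfl fun k _ => ?_
      refine (productExpectation_block (A x k) (B y k)
        (fun s => (V x).submatrix (Prod.mk s) id * ψ)).trans ?_
      rw [Fintype.sum_prod_type]
      refine Finset.sum_congr rfl fun s _ => Finset.sum_congr rfl fun t _ => ?_
      rw [productExpectation_conj]
  | @bobSend α β β' _ W h next ih =>
    intro _ _
    obtain ⟨κ, _, A, B, hκ, hA, hB, hAB⟩ := ih
    refine ⟨κ × (ℤˣ × ℤˣ), inferInstance,
      fun x k => (A x k.1).submatrix (Prod.mk k.2.1) (Prod.mk k.2.2),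
      fun y k => ((W y).submatrix (Prod.mk k.2.1) id)ᴴ * B y k.1 *
        (W y).submatrix (Prod.mk k.2.2) id, ?_, ?_, ?_, ?_⟩
    · rw [Fintype.card_prod, hκ, hcard, cost, pow_succ]
    · exact fun y k => (hA _ _).submatrix (hinj _) (hinj _)
    · intro y k
      have hV := (h y).isContractionMatrix
      exact ((hV.submatrix_left (hinj _)).conjTranspose.mul (hB _ _)).mul
        (hV.submatrix_left (hinj _))
    · intro x y ψ
      simp only [outputProb]
      rw [hAB, Fintype.sum_prod_type]
      refine Finset.sum_congr rfl fun k _ => ?_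
      have e : (Matrix.of fun (si : QubitBasis × α) j => (ψ * (W y)ᵀ) si.2 (si.1, j)) =
          (Matrix.of fun j (si : QubitBasis × α) =>
            ((W y).submatrix (Prod.mk si.1) id * ψᵀ) j si.2)ᵀ := by
        ext ⟨t, i⟩ j
        change (ψ * (W y)ᵀ) i (t, j) = ((W y) * ψᵀ) (t, j) i
        rw [← Matrix.transpose_apply (W y * ψᵀ), Matrix.transpose_mul, Matrix.transpose_transpose]
      rw [e, productExpectation_transpose, productExpectation_block (B y k) (A x k)
        (fun s => (W y).submatrix (Prod.mk s) id * ψᵀ), Fintype.sum_prod_type]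
      refine Finset.sum_congr rfl fun s _ => Finset.sum_congr rfl fun t _ => ?_
      rw [← productExpectation_transpose, productExpectation_conj]
  | @aliceOutput α β α' _ V h =>
    intro _ _
    refine ⟨Unit, inferInstance, fun x _ => ((V x).submatrix (Prod.mk s) id)ᴴ *
      (1 : Matrix α' α' ℂ) * (V x).submatrix (Prod.mk s) id, fun _ _ => 1, by simp [cost], ?_, ?_, ?_⟩
    · intro x k
      have hV := (h x).isContractionMatrix
      exact ((hV.submatrix_left (hinj _)).conjTranspose.mul .one).mul
        (hV.submatrix_left (hinj _))
    · exact fun _ _ => .one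
    · intro x y ψ
      simp only [Finset.univ_unique, Finset.sum_singleton]
      rw [productExpectation_conj]
      simp only [outputProb, Matrix.one_mul, Matrix.transpose_one, Matrix.mul_one]
      push_cast
      refine Finset.sum_congr rfl fun i _ => Finset.sum_congr rfl fun j _ => ?_
      rw [RCLike.star_def, Complex.conj_mul']
      rfl
  | @bobOutput α β β' _ W h =>
    intro _ _
    refine ⟨Unit, inferInstance, fun _ _ => 1, fun y _ => ((W y).submatrix (Prod.mk s) id)ᴴ *
      (1 : Matrix β' β' ℂ) * (W y).submatrix (Prod.mk s) id, by simp [cost], ?_, ?_, ?_⟩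
    · exact fun _ _ => .one
    · intro x k
      have hV := (h x).isContractionMatrix
      exact ((hV.submatrix_left (hinj _)).conjTranspose.mul .one).mul
        (hV.submatrix_left (hinj _))
    · intro x y ψ
      simp only [Finset.univ_unique, Finset.sum_singleton]
      rw [← productExpectation_transpose, productExpectation_conj]
      simp only [outputProb, Matrix.one_mul, Matrix.transpose_one, Matrix.mul_one]
      push_cast
      rw [Finset.sum_comm]
      refine Finset.sum_congr rfl fun i _ => Finset.sum_congr rfl fun j _ => ?_
      have e : ((W y).submatrix (Prod.mk s) id * ψᵀ) i j = (ψ * (W y)ᵀ) j (s, i) := by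
        change ((W y) * ψᵀ) (s, i) j = _
        rw [← Matrix.transpose_apply (W y * ψᵀ), Matrix.transpose_mul, Matrix.transpose_transpose]
      rw [e, RCLike.star_def, Complex.conj_mul']

end QuantumSteps

namespace QuantumProtocol

variable {X Y : Type*} (P : QuantumProtocol X Y)

theorem outputProb_nonneg (x : X) (y : Y) (s : ℤˣ) : 0 ≤ P.outputProb x y s := by
  let _ := P.fintypeAlice
  let _ := P.fintypeBob
  exact P.steps.outputProb_nonneg x y s P.initial

theorem outputProb_add (x : X) (y : Y) : P.outputProb x y 1 + P.outputProb x y (-1) = 1 := by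
  let _ := P.fintypeAlice
  let _ := P.fintypeBob
  have h := P.steps.sum_outputProb x y P.initial
  rw [P.initial_unit, show (Finset.univ : Finset ℤˣ) = {1, -1} from rfl,
    Finset.sum_pair (by decide)] at h
  exact h

/-- Each term `⟨ψ, (A ⊗ B) ψ⟩` is the inner product of `Aᴴ ψ` with `ψ Bᵀ`, two vectors of norm at
most one. Concatenating over the `4 ^ P.cost` terms gives `u` and `v`. -/
theorem exists_outputProb_eq_inner (s : ℤˣ) :
    ∃ (κ : Type) (_ : Fintype κ) (u : X → κ → ℂ) (v : Y → κ → ℂ),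
      (∀ x, ∑ k, ‖u x k‖ ^ 2 ≤ 4 ^ P.cost) ∧ (∀ y, ∑ k, ‖v y k‖ ^ 2 ≤ 4 ^ P.cost) ∧
      ∀ x y, (P.outputProb x y s : ℂ) = ∑ k, u x k * v y k := by
  let _ := P.fintypeAlice
  let _ := P.fintypeBob
  obtain ⟨κ, _, A, B, hκ, hA, hB, hAB⟩ :=
    P.steps.exists_outputProb_eq_sum_productExpectation s
  have hκ' : (Fintype.card κ : ℝ) = 4 ^ P.cost := by
    rw [hκ]; push_cast; rfl
  refine ⟨κ × P.α × P.β, inferInstance,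
    fun x k => star (((A x k.1)ᴴ * P.initial) k.2.1 k.2.2),
    fun y k => (P.initial * (B y k.1)ᵀ) k.2.1 k.2.2, ?_, ?_, ?_⟩
  · intro x
    simp only [Fintype.sum_prod_type, norm_star]
    calc _ ≤ ∑ k : κ, (1 : ℝ) := Finset.sum_le_sum fun k _ =>
          ((hA x k).conjTranspose.sum_norm_sq_mul_le _).trans P.initial_unit.le
      _ = _ := by simp [hκ']
  · intro y
    simp only [Fintype.sum_prod_type]
    calc _ ≤ ∑ k : κ, (1 : ℝ) := Finset.sum_le_sum fun k _ =>
          ((hB y k).sum_norm_sq_mul_transpose_le _).trans P.initial_unit.le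
      _ = _ := by simp [hκ']
  · intro x y
    rw [show P.outputProb x y s = P.steps.outputProb x y s P.initial from rfl, hAB,
      Fintype.sum_prod_type]
    refine Finset.sum_congr rfl fun k _ => ?_
    rw [Fintype.sum_prod_type]
    classical
    have := productExpectation_conj (A x k)ᴴ 1 1 (B y k) P.initial
    simpa only [Matrix.conjTranspose_conjTranspose, Matrix.mul_one, Matrix.one_mul] using this

theorem outputProb_eq_of_cost_eq_zero (hP : P.cost = 0) (s : ℤˣ) :
    (∀ x y y', P.outputProb x y s = P.outputProb x y' s) ∨
      (∀ x x' y, P.outputProb x y s = P.outputProb x' y s) := by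
  let _ := P.fintypeAlice
  let _ := P.fintypeBob
  exact P.steps.outputProb_eq_of_cost_eq_zero hP s P.initial

end QuantumProtocol

/-! ### Fourier analysis on matrices and the discrepancy method. -/

section Fourier

variable {𝔽 : Type*} [Field 𝔽] [Fintype 𝔽]

/-- A fixed nontrivial complex character of the additive group of a finite field. -/
noncomputable def fieldChar (𝔽 : Type*) [Field 𝔽] [Fintype 𝔽] : AddChar 𝔽 ℂ :=
  AddChar.FiniteField.primitiveChar_to_Complex 𝔽

theorem fieldChar_isPrimitive : (fieldChar 𝔽).IsPrimitive :=
  AddChar.FiniteField.primitiveChar_to_Complex_isPrimitive 𝔽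

theorem sum_fieldChar_trace {p r : Type*} [Fintype p] [Fintype r] [DecidableEq p] [DecidableEq r]
    [DecidableEq 𝔽] (X : Matrix r p 𝔽) :
    ∑ Z : Matrix p r 𝔽, fieldChar 𝔽 (Z * X).trace =
      if X = 0 then (Fintype.card (Matrix p r 𝔽) : ℂ) else 0 := by
  split_ifs with h
  · subst h
    simp
  · obtain ⟨i, j, hij⟩ : ∃ i j, X i j ≠ 0 := by
      by_contra! h'
      exact h (Matrix.ext h')
    let Ψ : AddChar (Matrix p r 𝔽) ℂ := (fieldChar 𝔽).compAddMonoidHom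
      { toFun := fun Z => (Z * X).trace
        map_zero' := by simp
        map_add' := fun Y Z => by rw [Matrix.add_mul, Matrix.trace_add] }
    have hΨ : Ψ ≠ 1 := by
      intro h1
      refine fieldChar_isPrimitive hij ?_
      ext a
      have h2 : Ψ (Matrix.single j i a) = 1 := by rw [h1]; rfl
      rw [AddChar.mulShift_apply, mul_comm, AddChar.one_apply, ← h2]
      change _ = fieldChar 𝔽 (Matrix.single j i a * X).trace
      rw [Matrix.trace_single_mul, smul_eq_mul]
    exact AddChar.sum_eq_zero_of_ne_one hΨ

variable {ι : Type*} [Fintype ι] [DecidableEq ι]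

/-- The Fourier transform of a function of a square matrix over a finite field. -/
noncomputable def matrixFourier (f : Matrix ι ι 𝔽 → ℂ) (M : Matrix ι ι 𝔽) : ℂ :=
  ∑ X, f X * fieldChar 𝔽 (M * X).trace

variable [DecidableEq 𝔽]

theorem matrixFourier_inversion (f : Matrix ι ι 𝔽 → ℂ) (X : Matrix ι ι 𝔽) :
    ∑ M, matrixFourier f M * fieldChar 𝔽 (-(M * X).trace) =
      Fintype.card (Matrix ι ι 𝔽) * f X := by
  unfold matrixFourier
  simp only [Finset.sum_mul, mul_assoc]
  rw [Finset.sum_comm]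
  have h : ∀ Y M : Matrix ι ι 𝔽, fieldChar 𝔽 (M * Y).trace * fieldChar 𝔽 (-(M * X).trace) =
      fieldChar 𝔽 (M * (Y - X)).trace := by
    intro Y M
    rw [← AddChar.map_add_eq_mul, Matrix.mul_sub, Matrix.trace_sub, sub_eq_add_neg]
  simp only [h, ← Finset.mul_sum, sum_fieldChar_trace, sub_eq_zero, mul_ite, mul_zero,
    Finset.sum_ite_eq', Finset.mem_univ, if_true]
  rw [mul_comm]

theorem sum_norm_sq_matrixFourier (f : Matrix ι ι 𝔽 → ℂ) :
    ∑ M, ‖matrixFourier f M‖ ^ 2 = Fintype.card (Matrix ι ι 𝔽) * ∑ X, ‖f X‖ ^ 2 := by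
  have h : ((∑ M, ‖matrixFourier f M‖ ^ 2 : ℝ) : ℂ) =
      ((Fintype.card (Matrix ι ι 𝔽) * ∑ X, ‖f X‖ ^ 2 : ℝ) : ℂ) := by
    push_cast
    simp only [← Complex.mul_conj']
    have h1 : ∀ M, (starRingEnd ℂ) (matrixFourier f M) =
        ∑ X, (starRingEnd ℂ) (f X) * fieldChar 𝔽 (-(M * X).trace) := by
      intro M
      simp only [matrixFourier, map_sum, map_mul, ← AddChar.map_neg_eq_conj]
    simp only [h1, Finset.mul_sum]
    rw [Finset.sum_comm]
    refine Finset.sum_congr rfl fun X _ => ?_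
    have h2 := matrixFourier_inversion f X
    rw [← mul_assoc, ← h2, Finset.sum_mul]
    exact Finset.sum_congr rfl fun M _ => by ring
  exact_mod_cast h

/-- Characters diagonalize the kernel `φ (A + B)`, so its operator norm is at most `ε`. Concretely,
invert the transform of `φ`, bound each product of transforms of `u` and `v` by the mean of squares,
and apply Plancherel. -/
theorem norm_sum_inner_mul_le {κ : Type*} [Fintype κ] (u v : Matrix ι ι 𝔽 → κ → ℂ) {K ε : ℝ}
    (hu : ∀ A, ∑ k, ‖u A k‖ ^ 2 ≤ K) (hv : ∀ A, ∑ k, ‖v A k‖ ^ 2 ≤ K)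
    (φ : Matrix ι ι 𝔽 → ℂ) (hφ : ∀ M, ‖matrixFourier φ M‖ ≤ ε) :
    ‖∑ A, ∑ B, (∑ k, u A k * v B k) * φ (A + B)‖ ≤ Fintype.card (Matrix ι ι 𝔽) * (K * ε) := by
  set N : ℝ := (Fintype.card (Matrix ι ι 𝔽) : ℝ) with hN
  have hN0 : 0 < N := by rw [hN]; exact_mod_cast Fintype.card_pos
  have hε : 0 ≤ ε := (norm_nonneg _).trans (hφ 0)
  have key : (N : ℂ) * ∑ A, ∑ B, (∑ k, u A k * v B k) * φ (A + B) =
      ∑ M, matrixFourier φ M * ∑ k, matrixFourier (fun A => u A k) (-M) *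
        matrixFourier (fun B => v B k) (-M) := by
    have h1 : ∀ A B, (N : ℂ) * ((∑ k, u A k * v B k) * φ (A + B)) =
        ∑ M, ∑ k, matrixFourier φ M * ((u A k * fieldChar 𝔽 (-M * A).trace) *
          (v B k * fieldChar 𝔽 (-M * B).trace)) := by
      intro A B
      have h2 := matrixFourier_inversion φ (A + B)
      rw [hN, Complex.ofReal_natCast, mul_left_comm, ← h2, Finset.mul_sum]
      refine Finset.sum_congr rfl fun M _ => ?_
      rw [Matrix.mul_add, Matrix.trace_add, neg_add, AddChar.map_add_eq_mul, Finset.sum_mul]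
      refine Finset.sum_congr rfl fun k _ => ?_
      rw [Matrix.neg_mul, Matrix.neg_mul, Matrix.trace_neg, Matrix.trace_neg]
      ring
    simp only [Finset.mul_sum _ _ (N : ℂ), h1]
    have h3 : ∀ M k, matrixFourier (fun A => u A k) (-M) * matrixFourier (fun B => v B k) (-M) =
        ∑ A, ∑ B, (u A k * fieldChar 𝔽 (-M * A).trace) *
          (v B k * fieldChar 𝔽 (-M * B).trace) := by
      intro M k
      simp only [matrixFourier, Finset.sum_mul_sum]
    simp only [h3]
    rw [Finset.sum_congr rfl fun A _ => Finset.sum_comm, Finset.sum_comm]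
    refine Finset.sum_congr rfl fun M _ => ?_
    rw [Finset.sum_congr rfl fun A _ => Finset.sum_comm, Finset.sum_comm, Finset.mul_sum]
    refine Finset.sum_congr rfl fun k _ => ?_
    simp only [Finset.mul_sum]
  have hsum : ∀ w : Matrix ι ι 𝔽 → κ → ℂ, (∀ A, ∑ k, ‖w A k‖ ^ 2 ≤ K) →
      ∑ M, ∑ k, ‖matrixFourier (fun A => w A k) (-M)‖ ^ 2 ≤ N * (N * K) := by
    intro w hw
    rw [Finset.sum_comm]
    have h3 : ∀ k, ∑ M, ‖matrixFourier (fun A => w A k) (-M)‖ ^ 2 = N * ∑ A, ‖w A k‖ ^ 2 := by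
      intro k
      rw [hN, ← sum_norm_sq_matrixFourier]
      exact Fintype.sum_equiv (Equiv.neg _) _ _ fun _ => rfl
    simp only [h3, ← Finset.mul_sum]
    rw [Finset.sum_comm]
    refine mul_le_mul_of_nonneg_left ?_ hN0.le
    calc _ ≤ ∑ A : Matrix ι ι 𝔽, K := Finset.sum_le_sum fun A _ => hw A
      _ = _ := by rw [Finset.sum_const, nsmul_eq_mul, hN]; rfl
  have hle : N * ‖∑ A, ∑ B, (∑ k, u A k * v B k) * φ (A + B)‖ ≤ N * (N * (K * ε)) := by
    calc _ = ‖(N : ℂ) * ∑ A, ∑ B, (∑ k, u A k * v B k) * φ (A + B)‖ := by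
          rw [norm_mul, Complex.norm_real, Real.norm_of_nonneg hN0.le]
      _ ≤ ∑ M, ‖matrixFourier φ M‖ * ∑ k, (‖matrixFourier (fun A => u A k) (-M)‖ *
            ‖matrixFourier (fun B => v B k) (-M)‖) := by
          rw [key]
          refine (norm_sum_le _ _).trans (Finset.sum_le_sum fun M _ => ?_)
          rw [norm_mul]
          refine mul_le_mul_of_nonneg_left ((norm_sum_le _ _).trans_eq ?_) (norm_nonneg _)
          simp only [norm_mul]
      _ ≤ ∑ M, ε * ∑ k, ((‖matrixFourier (fun A => u A k) (-M)‖ ^ 2 +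
            ‖matrixFourier (fun B => v B k) (-M)‖ ^ 2) / 2) := by
          refine Finset.sum_le_sum fun M _ => ?_
          refine mul_le_mul (hφ M) ?_ (by positivity) hε
          refine Finset.sum_le_sum fun k _ => ?_
          nlinarith [sq_nonneg (‖matrixFourier (fun A => u A k) (-M)‖ -
            ‖matrixFourier (fun B => v B k) (-M)‖)]
      _ = ε * ((∑ M, ∑ k, ‖matrixFourier (fun A => u A k) (-M)‖ ^ 2 +
            ∑ M, ∑ k, ‖matrixFourier (fun A => v A k) (-M)‖ ^ 2) / 2) := by
          simp only [← Finset.mul_sum, ← Finset.sum_div, Finset.sum_add_distrib]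
      _ ≤ ε * ((N * (N * K) + N * (N * K)) / 2) := by
          have := hsum u hu
          have := hsum v hv
          gcongr
      _ = _ := by ring
  exact le_of_mul_le_mul_left hle hN0

/-- The discrepancy method for a problem that depends on the sum of the two inputs: `φ` is a
signed weight, and `S` is a set of inputs on which the sign of `φ` is that of the problem. -/
theorem QuantumProtocol.discrepancy_bound
    (P : QuantumProtocol (Matrix ι ι 𝔽) (Matrix ι ι 𝔽)) (f : Matrix ι ι 𝔽 → Option ℤˣ) {δ ε : ℝ}
    (hP : P.HasError (fun A B => f (A + B)) (1 / 2 - δ / 2))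
    (φ : Matrix ι ι 𝔽 → ℝ) (hφ0 : ∑ X, φ X = 0)
    (hφ : ∀ M, ‖matrixFourier (fun X => (φ X : ℂ)) M‖ ≤ ε) (S : Finset (Matrix ι ι 𝔽))
    (hS : ∀ X ∈ S, (f X = some 1 ∧ 0 ≤ φ X) ∨ (f X = some (-1) ∧ φ X ≤ 0)) :
    δ * ∑ X ∈ S, |φ X| - ∑ X ∈ Sᶜ, |φ X| ≤ 2 * 4 ^ P.cost * ε := by
  obtain ⟨κ, _, u, v, hu, hv, huv⟩ := P.exists_outputProb_eq_inner 1
  set N : ℝ := (Fintype.card (Matrix ι ι 𝔽) : ℝ) with hN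
  have hN0 : 0 < N := by rw [hN]; exact_mod_cast Fintype.card_pos
  have h1 := norm_sum_inner_mul_le u v hu hv (fun X => (φ X : ℂ)) hφ
  have h2 : ∑ A, ∑ B, P.outputProb A B 1 * φ (A + B) ≤ N * (4 ^ P.cost * ε) := by
    refine le_trans ?_ h1
    simp only [← huv]
    refine (Complex.re_le_norm _).trans' (le_of_eq ?_)
    simp only [← Complex.ofReal_mul, ← Complex.ofReal_sum, Complex.ofReal_re]
  have hshift : ∀ (A : Matrix ι ι 𝔽) (g : Matrix ι ι 𝔽 → ℝ), ∑ B, g (A + B) = ∑ X, g X :=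
    fun A g => Fintype.sum_equiv (Equiv.addLeft A) _ _ fun _ => rfl
  -- `L` bounds `(Pr[output 1] - 1/2) * φ` from below: on `S` correctness gives advantage `δ / 2`,
  -- elsewhere only `|Pr - 1/2| ≤ 1/2` is available. The subtracted `1/2` costs nothing because `φ`
  -- sums to zero.
  set L : Matrix ι ι 𝔽 → ℝ := fun X => if X ∈ S then δ / 2 * |φ X| else -(1 / 2 * |φ X|)
    with hL
  have hpt : ∀ A B, L (A + B) ≤ P.outputProb A B 1 * φ (A + B) - 1 / 2 * φ (A + B) := by
    intro A B
    have hp1 := P.outputProb_nonneg A B 1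
    have hp2 := P.outputProb_nonneg A B (-1)
    have hp3 := P.outputProb_add A B
    simp only [hL]
    split_ifs with hX
    · rcases hS _ hX with ⟨hf, hs⟩ | ⟨hf, hs⟩
      · have := hP A B _ hf
        rw [abs_of_nonneg hs]
        nlinarith
      · have := hP A B _ hf
        rw [abs_of_nonpos hs]
        nlinarith
    · rcases abs_cases (φ (A + B)) with ⟨h, h'⟩ | ⟨h, h'⟩ <;> rw [h] <;> nlinarith
  have h3 : ∑ A : Matrix ι ι 𝔽, ∑ B, L (A + B) ≤ N * (4 ^ P.cost * ε) := by
    refine (Finset.sum_le_sum fun A _ => Finset.sum_le_sum fun B _ => hpt A B).trans ?_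
    simp only [Finset.sum_sub_distrib, ← Finset.mul_sum, hshift _ φ, hφ0]
    simpa using h2
  simp only [hshift _ L] at h3
  rw [Finset.sum_const, nsmul_eq_mul, Finset.card_univ, ← hN] at h3
  have h4 := le_of_mul_le_mul_left h3 hN0
  have h5 : ∑ X, L X = δ / 2 * ∑ X ∈ S, |φ X| - 1 / 2 * ∑ X ∈ Sᶜ, |φ X| := by
    rw [← Finset.sum_add_sum_compl S, Finset.mul_sum, Finset.mul_sum, sub_eq_add_neg,
      ← Finset.sum_neg_distrib]
    congr 1
    · exact Finset.sum_congr rfl fun X hX => by simp [hL, hX]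
    · exact Finset.sum_congr rfl fun X hX => by simp [hL, Finset.mem_compl.1 hX]
  linarith

end Fourier

/-! ### Orbits under determinant-one matrices and transforms of invariant functions. -/

section MatrixOrbits

variable {𝔽 : Type*} [Field 𝔽] {n : ℕ}

/-- Take `D = 1 + v wᵀ` with `v` a nonzero kernel vector and `wᵀ v = t - 1`. -/
theorem Matrix.exists_det_eq_mul_eq_self {M : Matrix (Fin n) (Fin n) 𝔽} (hM : M.det = 0) (t : 𝔽) :
    ∃ D : Matrix (Fin n) (Fin n) 𝔽, D.det = t ∧ M * D = M := by
  obtain ⟨v, hv, hMv⟩ := Matrix.exists_mulVec_eq_zero_iff.2 hM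
  obtain ⟨i, hi⟩ := Function.ne_iff.1 hv
  refine ⟨1 + Matrix.replicateCol Unit v *
    Matrix.replicateRow Unit (Pi.single i ((t - 1) / v i)), ?_, ?_⟩
  · rw [Matrix.det_one_add_replicateCol_mul_replicateRow, single_dotProduct,
      div_mul_cancel₀ _ hi]
    ring
  · rw [Matrix.mul_add, ← Matrix.mul_assoc, ← Matrix.replicateCol_mulVec, hMv]
    simp

theorem Matrix.exists_det_eq_mul_self_eq {M : Matrix (Fin n) (Fin n) 𝔽} (hM : M.det = 0) (t : 𝔽) :
    ∃ D : Matrix (Fin n) (Fin n) 𝔽, D.det = t ∧ D * M = M := by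
  obtain ⟨D, hD, h⟩ := Matrix.exists_det_eq_mul_eq_self (M := Mᵀ) (by rwa [Matrix.det_transpose]) t
  refine ⟨Dᵀ, by rwa [Matrix.det_transpose], ?_⟩
  rw [← Matrix.transpose_inj, Matrix.transpose_mul, Matrix.transpose_transpose, h]

theorem Matrix.det_eq_zero_iff_rank_lt {M : Matrix (Fin n) (Fin n) 𝔽} :
    M.det = 0 ↔ M.rank < n := by
  constructor
  · intro h
    obtain ⟨v, hv, hMv⟩ := Matrix.exists_mulVec_eq_zero_iff.2 h
    have h1 := LinearMap.finrank_range_add_finrank_ker M.mulVecLin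
    have h2 : 0 < Module.finrank 𝔽 (LinearMap.ker M.mulVecLin) := by
      rw [Module.finrank_pos_iff_exists_ne_zero]
      exact ⟨⟨v, by simpa using hMv⟩, fun h => hv (congrArg Subtype.val h)⟩
    rw [Module.finrank_fintype_fun_eq_card, Fintype.card_fin] at h1
    change M.rank + _ = n at h1
    omega
  · intro h
    by_contra h'
    have := Matrix.rank_of_det_ne_zero h'
    rw [this, Fintype.card_fin] at h
    exact lt_irrefl _ h

theorem Matrix.exists_mul_mul_eq_of_rank_eq {M M' : Matrix (Fin n) (Fin n) 𝔽}
    (h : M.rank = M'.rank) : ∃ P Q : Matrix (Fin n) (Fin n) 𝔽,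
      IsUnit P ∧ IsUnit Q ∧ P * M * Q = M' := by
  have normal : ∀ (k : ℕ) (M : Matrix (Fin n) (Fin n) 𝔽), M.rank = k →
      ∃ (V U : Matrix (Fin n) (Fin n) 𝔽) (e : Fin n ≃ Fin k ⊕ Fin (n - k)), IsUnit V ∧ IsUnit U ∧
        V * M * U = (Matrix.fromBlocks 1 0 0 0).submatrix e e := by
    rintro k M rfl
    have := M.exists_rank_normal_form
    rwa [Fintype.card_fin] at this
  obtain ⟨V, U, e, hV, hU, hM⟩ := normal _ M h
  obtain ⟨V', U', e', hV', hU', hM'⟩ := normal _ M' rfl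
  set σ : Equiv.Perm (Fin n) := e'.trans e.symm with hσ
  have hperm : (Matrix.submatrix (1 : Matrix (Fin n) (Fin n) 𝔽) σ (Equiv.refl (Fin n))) * (V * M * U) *
      (Matrix.submatrix (1 : Matrix (Fin n) (Fin n) 𝔽) (Equiv.refl (Fin n)) σ) = V' * M' * U' := by
    rw [hM', hM, Matrix.one_submatrix_mul, Matrix.mul_submatrix_one]
    ext i j
    simp [hσ]
  have hσ1 : IsUnit (Matrix.submatrix (1 : Matrix (Fin n) (Fin n) 𝔽) σ (Equiv.refl (Fin n))) := by
    refine IsUnit.of_mul_eq_one (Matrix.submatrix 1 (Equiv.refl (Fin n)) σ) ?_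
    rw [Matrix.one_submatrix_mul]
    ext i j
    simp [Matrix.one_apply]
  have hσ2 : IsUnit (Matrix.submatrix (1 : Matrix (Fin n) (Fin n) 𝔽) (Equiv.refl (Fin n)) σ) := by
    refine IsUnit.of_mul_eq_one (Matrix.submatrix 1 σ (Equiv.refl (Fin n))) ?_
    rw [Matrix.mul_submatrix_one]
    ext i j
    simp [Matrix.one_apply]
  obtain ⟨V'', hV''⟩ := hV'
  obtain ⟨U'', hU''⟩ := hU'
  refine ⟨(↑(V''⁻¹) : Matrix (Fin n) (Fin n) 𝔽) * Matrix.submatrix 1 σ (Equiv.refl (Fin n)) * V, U * Matrix.submatrix 1 (Equiv.refl (Fin n)) σ *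
      (↑(U''⁻¹) : Matrix (Fin n) (Fin n) 𝔽),
    (V''⁻¹.isUnit.mul hσ1).mul hV, (hU.mul hσ2).mul U''⁻¹.isUnit, ?_⟩
  calc _ = (↑(V''⁻¹) : Matrix (Fin n) (Fin n) 𝔽) * (Matrix.submatrix 1 σ (Equiv.refl (Fin n)) * (V * M * U) * Matrix.submatrix 1 (Equiv.refl (Fin n)) σ) *
        (↑(U''⁻¹) : Matrix (Fin n) (Fin n) 𝔽) := by simp only [Matrix.mul_assoc]
    _ = M' := by
      rw [hperm, ← hV'', ← hU'', Matrix.mul_assoc, Matrix.mul_assoc, Units.mul_inv,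
        Matrix.mul_one, ← Matrix.mul_assoc, Units.inv_mul, Matrix.one_mul]

/-- Singularity leaves room to correct determinants: `M` is fixed by factors of any prescribed
determinant, so those of `P` and `Q` can be normalized to one. -/
theorem Matrix.exists_mul_mul_eq_of_rank_eq_of_lt {M M' : Matrix (Fin n) (Fin n) 𝔽}
    (h : M.rank = M'.rank) (hn : M.rank < n) : ∃ P Q : Matrix (Fin n) (Fin n) 𝔽,
      P.det = 1 ∧ Q.det = 1 ∧ P * M * Q = M' := by
  obtain ⟨P, Q, hP, hQ, hPQ⟩ := Matrix.exists_mul_mul_eq_of_rank_eq h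
  have hM := Matrix.det_eq_zero_iff_rank_lt.2 hn
  have hP0 := ((Matrix.isUnit_iff_isUnit_det _).1 hP).ne_zero
  have hQ0 := ((Matrix.isUnit_iff_isUnit_det _).1 hQ).ne_zero
  obtain ⟨D, hD, hMD⟩ := Matrix.exists_det_eq_mul_eq_self hM (Q.det)⁻¹
  obtain ⟨E, hE, hME⟩ := Matrix.exists_det_eq_mul_self_eq hM (P.det)⁻¹
  refine ⟨P * E, D * Q, ?_, ?_, ?_⟩
  · rw [Matrix.det_mul, hE, mul_inv_cancel₀ hP0]
  · rw [Matrix.det_mul, hD, inv_mul_cancel₀ hQ0]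
  · calc P * E * M * (D * Q) = P * ((E * M) * D) * Q := by simp only [Matrix.mul_assoc]
      _ = M' := by rw [hME, hMD, hPQ]

/-- Invariance under multiplication by matrices of determinant one, on both sides. -/
def IsSLInvariant {R : Type*} (φ : Matrix (Fin n) (Fin n) 𝔽 → R) : Prop :=
  ∀ P Q X : Matrix (Fin n) (Fin n) 𝔽, P.det = 1 → Q.det = 1 → φ (P * X * Q) = φ X

theorem IsSLInvariant.eq_of_rank_eq {R : Type*} {φ : Matrix (Fin n) (Fin n) 𝔽 → R}
    (hφ : IsSLInvariant φ) {M M' : Matrix (Fin n) (Fin n) 𝔽}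
    (h : M.rank = M'.rank) (hn : M.rank < n) : φ M = φ M' := by
  obtain ⟨P, Q, hP, hQ, rfl⟩ := Matrix.exists_mul_mul_eq_of_rank_eq_of_lt h hn
  exact (hφ P Q M hP hQ).symm

theorem IsSLInvariant.eq_of_det_eq {R : Type*} {φ : Matrix (Fin n) (Fin n) 𝔽 → R}
    (hφ : IsSLInvariant φ) {M M' : Matrix (Fin n) (Fin n) 𝔽}
    (h : M.det = M'.det) (h0 : M.det ≠ 0) : φ M = φ M' := by
  have hu : IsUnit M.det := IsUnit.mk0 _ h0
  have := hφ (M' * M⁻¹) 1 M (by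
    rw [Matrix.det_mul, Matrix.det_nonsing_inv, Ring.inverse_eq_inv', ← h, mul_inv_cancel₀ h0])
    Matrix.det_one
  rw [Matrix.mul_one, Matrix.mul_assoc, Matrix.nonsing_inv_mul _ hu, Matrix.mul_one] at this
  exact this.symm

variable [Fintype 𝔽] {φ : Matrix (Fin n) (Fin n) 𝔽 → ℂ}

theorem IsSLInvariant.matrixFourier (hφ : IsSLInvariant φ) :
    IsSLInvariant (matrixFourier φ) := by
  intro P Q M hP hQ
  have hPu : IsUnit P := (Matrix.isUnit_iff_isUnit_det _).2 (by rw [hP]; exact isUnit_one)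
  have hQu : IsUnit Q := (Matrix.isUnit_iff_isUnit_det _).2 (by rw [hQ]; exact isUnit_one)
  have hbij : Function.Bijective fun X => Q * X * P := by
    have h1 : Function.Injective fun X => Q * X * P :=
      hPu.mul_left_injective.comp hQu.mul_right_injective
    exact Finite.injective_iff_bijective.1 h1
  refine Fintype.sum_bijective _ hbij _ _ fun X => ?_
  rw [hφ Q P X hQ hP, Matrix.mul_assoc P, Matrix.mul_assoc P, Matrix.trace_mul_comm P]
  simp only [Matrix.mul_assoc]

variable [DecidableEq 𝔽]

theorem Matrix.card_mul_eq_zero (X : Matrix (Fin n) (Fin n) 𝔽) (j : ℕ) :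
    Fintype.card {Y : Matrix (Fin n) (Fin j) 𝔽 // X * Y = 0} =
      Fintype.card 𝔽 ^ (j * (n - X.rank)) := by
  classical
  have e : {Y : Matrix (Fin n) (Fin j) 𝔽 // X * Y = 0} ≃ (Fin j → LinearMap.ker X.mulVecLin) :=
    { toFun := fun Y k => ⟨fun i => Y.1 i k, by
        rw [LinearMap.mem_ker]
        ext i
        exact congrFun (congrFun Y.2 i) k⟩
      invFun := fun g => ⟨Matrix.of fun i k => (g k).1 i, by
        ext i k
        exact congrFun (LinearMap.mem_ker.1 (g k).2) i⟩
      left_inv := fun _ => rfl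
      right_inv := fun _ => rfl }
  have h1 := LinearMap.finrank_range_add_finrank_ker X.mulVecLin
  rw [Module.finrank_fintype_fun_eq_card, Fintype.card_fin] at h1
  change X.rank + _ = n at h1
  rw [Fintype.card_congr e, Fintype.card_fun, Fintype.card_fin,
    Module.card_eq_pow_finrank (K := 𝔽) (V := LinearMap.ker X.mulVecLin), ← pow_mul, mul_comm j]
  congr 2
  omega

/-- Summing over `Z` forces `X * Y = 0`, and the solutions `Y` number `q ^ (j * corank X)`. This
ties the `j`-th moment of `φ` to Fourier coefficients at matrices of rank at most `j`. -/
theorem sum_matrixFourier_mul (φ : Matrix (Fin n) (Fin n) 𝔽 → ℂ) (j : ℕ) :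
    ∑ Y : Matrix (Fin n) (Fin j) 𝔽, ∑ Z : Matrix (Fin j) (Fin n) 𝔽, matrixFourier φ (Y * Z) =
      Fintype.card (Matrix (Fin j) (Fin n) 𝔽) *
        ∑ X, φ X * (Fintype.card 𝔽 : ℂ) ^ (j * (n - X.rank)) := by
  unfold matrixFourier
  have h1 : ∀ (X : Matrix (Fin n) (Fin n) 𝔽) (Y : Matrix (Fin n) (Fin j) 𝔽)
      (Z : Matrix (Fin j) (Fin n) 𝔽), (Y * Z * X).trace = (Z * (X * Y)).trace := by
    intro X Y Z
    rw [Matrix.mul_assoc, Matrix.trace_mul_comm, Matrix.mul_assoc]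
  have h2 : ∀ X : Matrix (Fin n) (Fin n) 𝔽, ∑ Y : Matrix (Fin n) (Fin j) 𝔽,
      ∑ Z : Matrix (Fin j) (Fin n) 𝔽, fieldChar 𝔽 (Y * Z * X).trace =
      Fintype.card (Matrix (Fin j) (Fin n) 𝔽) * (Fintype.card 𝔽 : ℂ) ^ (j * (n - X.rank)) := by
    intro X
    simp only [h1, sum_fieldChar_trace]
    rw [← Finset.sum_filter, Finset.sum_const, nsmul_eq_mul, mul_comm, ← Fintype.card_subtype,
      Matrix.card_mul_eq_zero]
    push_cast
    rfl
  rw [Finset.sum_congr rfl fun Y _ => Finset.sum_comm, Finset.sum_comm, Finset.mul_sum]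
  refine Finset.sum_congr rfl fun X _ => ?_
  simp only [← Finset.mul_sum, h2]
  ring

/-- Strong induction on the rank `j`. In the sum of the transform over products `Y * Z`, terms of
rank below `j` vanish by induction and those of rank `j < n` all equal the value at `M`. The
vanishing moment therefore kills that value. -/
theorem IsSLInvariant.matrixFourier_eq_zero (hφ : IsSLInvariant φ) {m : ℕ} (hm : m < n)
    (h : ∀ j ≤ m, ∑ X, φ X * (Fintype.card 𝔽 : ℂ) ^ (j * (n - X.rank)) = 0)
    (M : Matrix (Fin n) (Fin n) 𝔽) (hM : M.rank ≤ m) : _root_.matrixFourier φ M = 0 := by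
  induction hj : M.rank using Nat.strong_induction_on generalizing M with
  | _ j ih =>
    have hjm : j ≤ m := hj ▸ hM
    have h0 := sum_matrixFourier_mul φ j
    rw [h j hjm, mul_zero] at h0
    have hterm : ∀ (Y : Matrix (Fin n) (Fin j) 𝔽) (Z : Matrix (Fin j) (Fin n) 𝔽),
        _root_.matrixFourier φ (Y * Z) =
          if (Y * Z).rank = j then _root_.matrixFourier φ M else 0 := by
      intro Y Z
      have hle : (Y * Z).rank ≤ j := (Matrix.rank_mul_le_left Y Z).trans (Matrix.rank_le_width Y)
      split_ifs with hr
      · exact hφ.matrixFourier.eq_of_rank_eq (hr.trans hj.symm) (by omega)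
      · exact ih _ (lt_of_le_of_ne hle hr) _ (hle.trans hjm) rfl
    simp only [hterm, ← Fintype.sum_prod_type'] at h0
    rw [← Finset.sum_filter, Finset.sum_const, smul_eq_zero] at h0
    refine h0.resolve_left ?_
    rw [Finset.card_eq_zero, ← ne_eq, ← Finset.nonempty_iff_ne_empty]
    -- Some product must have rank exactly `j`: with `Y` the first `j` columns of the identity, `Y *
    -- Yᵀ` does.
    let Y : Matrix (Fin n) (Fin j) 𝔽 := (1 : Matrix (Fin n) (Fin n) 𝔽).submatrix id
      (Fin.castLE (by omega))
    have hY : Yᵀ * Y = 1 := by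
      have hinj : Function.Injective (Fin.castLE (n := j) (m := n) (by omega)) :=
        Fin.castLE_injective _
      rw [Matrix.transpose_submatrix, Matrix.transpose_one]
      ext a b
      simp only [Matrix.mul_apply, Matrix.submatrix_apply, id, Matrix.one_apply, Y]
      simp [hinj.eq_iff]
    refine ⟨(Y, Yᵀ), ?_⟩
    rw [Finset.mem_filter]
    refine ⟨Finset.mem_univ _, le_antisymm
      ((Matrix.rank_mul_le_left _ _).trans (Matrix.rank_le_width Y)) ?_⟩
    calc j = (1 : Matrix (Fin j) (Fin j) 𝔽).rank := by rw [Matrix.rank_one, Fintype.card_fin]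
      _ = (Yᵀ * (Y * Yᵀ) * Y).rank := by
        rw [← Matrix.mul_assoc, hY, Matrix.one_mul, hY]
      _ ≤ (Yᵀ * (Y * Yᵀ)).rank := Matrix.rank_mul_le_left _ _
      _ ≤ (Y * Yᵀ).rank := Matrix.rank_mul_le_right _ _

/-- Plancherel, keeping only the matrices with the rank of `M`, where the transform is constant. -/
theorem IsSLInvariant.norm_sq_matrixFourier_mul_card_rank (hφ : IsSLInvariant φ)
    {M : Matrix (Fin n) (Fin n) 𝔽} (hM : M.rank < n) :
    ‖_root_.matrixFourier φ M‖ ^ 2 *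
        (Finset.univ.filter fun X : Matrix (Fin n) (Fin n) 𝔽 => X.rank = M.rank).card ≤
      Fintype.card (Matrix (Fin n) (Fin n) 𝔽) * ∑ X, ‖φ X‖ ^ 2 := by
  rw [← sum_norm_sq_matrixFourier, mul_comm, ← nsmul_eq_mul, ← Finset.sum_const]
  refine le_trans (le_of_eq ?_) (Finset.sum_le_univ_sum_of_nonneg
    (s := Finset.univ.filter fun X : Matrix (Fin n) (Fin n) 𝔽 => X.rank = M.rank)
    fun _ => by positivity)
  refine Finset.sum_congr rfl fun X hX => ?_
  rw [hφ.matrixFourier.eq_of_rank_eq (Finset.mem_filter.1 hX).2.symm hM]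

theorem IsSLInvariant.norm_sq_matrixFourier_mul_card_det (hφ : IsSLInvariant φ)
    {M : Matrix (Fin n) (Fin n) 𝔽} (hM : M.det ≠ 0) :
    ‖_root_.matrixFourier φ M‖ ^ 2 *
        (Finset.univ.filter fun X : Matrix (Fin n) (Fin n) 𝔽 => X.det = M.det).card ≤
      Fintype.card (Matrix (Fin n) (Fin n) 𝔽) * ∑ X, ‖φ X‖ ^ 2 := by
  rw [← sum_norm_sq_matrixFourier, mul_comm, ← nsmul_eq_mul, ← Finset.sum_const]
  refine le_trans (le_of_eq ?_) (Finset.sum_le_univ_sum_of_nonneg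
    (s := Finset.univ.filter fun X : Matrix (Fin n) (Fin n) 𝔽 => X.det = M.det)
    fun _ => by positivity)
  refine Finset.sum_congr rfl fun X hX => ?_
  rw [hφ.matrixFourier.eq_of_det_eq (Finset.mem_filter.1 hX).2.symm hM]

end MatrixOrbits

/-! ### Sizes of rank and determinant classes. -/

theorem one_fourth_le_prod_one_sub_pow {x : ℝ} (hx0 : 0 ≤ x) (hx : x ≤ 1 / 2) (k : ℕ) :
    1 / 4 ≤ ∏ i ∈ Finset.range k, (1 - x ^ (i + 1)) := by
  -- The bound `1/4` alone is not inductive; the extra term pays for the next factor. The worst case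
  -- is `x = 1/2`.
  have h : ∀ k : ℕ, 1 / 4 + (1 / 2 : ℝ) ^ (k + 2) ≤
      ∏ i ∈ Finset.range (k + 1), (1 - (1 / 2 : ℝ) ^ (i + 1)) := by
    intro k
    induction k with
    | zero => norm_num
    | succ k ih =>
      rw [Finset.prod_range_succ]
      have h1 : (1 / 2 : ℝ) ^ (k + 1) ≤ 1 / 2 := pow_le_of_le_one (by norm_num) (by norm_num)
        (by omega)
      have h2 : (0 : ℝ) < (1 / 2) ^ (k + 1) := by positivity
      refine le_trans ?_ (mul_le_mul_of_nonneg_right ih (by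
        rw [pow_succ]; linarith))
      simp only [pow_succ] at h1 h2 ⊢
      nlinarith
  calc (1 / 4 : ℝ) ≤ ∏ i ∈ Finset.range k, (1 - (1 / 2 : ℝ) ^ (i + 1)) := by
        cases k with
        | zero => norm_num
        | succ k =>
          refine le_trans ?_ (h k)
          have : (0 : ℝ) < (1 / 2) ^ (k + 2) := by positivity
          linarith
    _ ≤ _ := by
        refine Finset.prod_le_prod (fun i _ => ?_) fun i _ => ?_
        · have : (1 / 2 : ℝ) ^ (i + 1) ≤ 1 := pow_le_one₀ (by norm_num) (by norm_num)
          linarith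
        · have : x ^ (i + 1) ≤ (1 / 2) ^ (i + 1) := pow_le_pow_left₀ hx0 hx _
          linarith

theorem Fintype.card_matrix_fin {𝔽 : Type*} [Fintype 𝔽] (m n : ℕ) :
    Fintype.card (Matrix (Fin m) (Fin n) 𝔽) = Fintype.card 𝔽 ^ (m * n) := by
  rw [Fintype.card_congr (Matrix.of (m := Fin m) (n := Fin n) (α := 𝔽)).symm, Fintype.card_fun,
    Fintype.card_fun, Fintype.card_fin, Fintype.card_fin, ← pow_mul, mul_comm]

section Counting

variable {𝔽 : Type*} [Field 𝔽] [Fintype 𝔽]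

theorem card_pow_sq_le_card_GL (r : ℕ) :
    (Fintype.card 𝔽 : ℝ) ^ (r ^ 2) ≤ 4 * Nat.card (GL (Fin r) 𝔽) := by
  have hq : 2 ≤ Fintype.card 𝔽 := Fintype.one_lt_card
  have hq' : (2 : ℝ) ≤ Fintype.card 𝔽 := by exact_mod_cast hq
  set q : ℝ := (Fintype.card 𝔽 : ℝ) with hqdef
  have hq0 : 0 < q := by linarith
  have h1 : (Nat.card (GL (Fin r) 𝔽) : ℝ) =
      ∏ i ∈ Finset.range r, (q ^ r * (1 - (q⁻¹) ^ (i + 1))) := by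
    rw [Matrix.card_GL_field, Fin.prod_univ_eq_prod_range
      (fun i => Fintype.card 𝔽 ^ r - Fintype.card 𝔽 ^ i), ← Finset.prod_range_reflect]
    push_cast
    refine Finset.prod_congr rfl fun i hi => ?_
    have hi' := Finset.mem_range.1 hi
    rw [Nat.cast_sub (Nat.pow_le_pow_right (by omega) (by omega))]
    push_cast
    rw [← hqdef, mul_sub, mul_one, inv_pow, ← div_eq_mul_inv]
    congr 1
    rw [eq_div_iff (by positivity), ← pow_add]
    congr 1
    omega
  rw [h1, Finset.prod_mul_distrib, Finset.prod_const, Finset.card_range, ← pow_mul, ← pow_two]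
  have h2 := one_fourth_le_prod_one_sub_pow (x := q⁻¹) (by positivity)
    (by rw [inv_le_comm₀ hq0 (by norm_num)]; norm_num; exact hq') r
  have h3 : 0 < q ^ r ^ 2 := by positivity
  nlinarith

variable [DecidableEq 𝔽]

theorem card_pow_le_card_rank_eq {n r : ℕ} (hr : r ≤ n) :
    (Fintype.card 𝔽 : ℝ) ^ (n ^ 2) ≤
      4 * (Finset.univ.filter fun X : Matrix (Fin n) (Fin n) 𝔽 => X.rank = r).card *
        (Fintype.card 𝔽 : ℝ) ^ ((n - r) ^ 2) := by
  obtain ⟨s, rfl⟩ := Nat.exists_eq_add_of_le hr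
  -- Only rank-`r` matrices with invertible top left block are counted: they factor as a column `(1,
  -- B)` times `A` times a row `(1, C)`, and already give the right order.
  let g : GL (Fin r) 𝔽 × Matrix (Fin s) (Fin r) 𝔽 × Matrix (Fin r) (Fin s) 𝔽 →
      Matrix (Fin r ⊕ Fin s) (Fin r ⊕ Fin s) 𝔽 := fun x =>
    Matrix.fromBlocks x.1.1 (x.1.1 * x.2.2) (x.2.1 * x.1.1) (x.2.1 * x.1.1 * x.2.2)
  have hg : Function.Injective g := by
    rintro ⟨A, B, C⟩ ⟨A', B', C'⟩ h
    obtain ⟨h1, h2, h3, -⟩ := Matrix.fromBlocks_inj.1 h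
    have hA : A = A' := Units.ext h1
    subst hA
    have h2' : C = C' := by
      have := congrArg (fun M => (A⁻¹).1 * M) h2
      simpa only [← Matrix.mul_assoc, Units.inv_eq_val_inv, Units.inv_mul, Matrix.one_mul]
        using this
    have h3' : B = B' := by
      have := congrArg (fun M => M * (A⁻¹).1) h3
      simpa only [Matrix.mul_assoc, Units.mul_inv, Matrix.mul_one] using this
    rw [h2', h3']
  have hrank : ∀ x, (g x).rank = r := by
    rintro ⟨A, B, C⟩
    have hA : A.1.rank = r := by
      rw [Matrix.rank_of_isUnit _ A.isUnit, Fintype.card_fin]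
    refine le_antisymm ?_ ?_
    · have : g (A, B, C) = Matrix.fromRows (1 : Matrix (Fin r) (Fin r) 𝔽) B * A.1 * Matrix.fromCols 1 C := by
        rw [Matrix.fromRows_mul, Matrix.fromRows_mul_fromCols]
        simp [g]
      rw [this]
      exact (Matrix.rank_mul_le_left _ _).trans ((Matrix.rank_mul_le_right _ _).trans hA.le)
    · have : A.1 = Matrix.fromCols (1 : Matrix (Fin r) (Fin r) 𝔽) (0 : Matrix (Fin r) (Fin s) 𝔽) *
          g (A, B, C) *
          Matrix.fromRows (1 : Matrix (Fin r) (Fin r) 𝔽) (0 : Matrix (Fin s) (Fin r) 𝔽) := by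
        simp only [g]
        rw [Matrix.fromCols_mul_fromBlocks, Matrix.fromCols_mul_fromRows]
        simp
      calc r = A.1.rank := hA.symm
        _ ≤ _ := by
          rw [this]
          exact (Matrix.rank_mul_le_left _ _).trans (Matrix.rank_mul_le_right _ _)
  have hcard : Fintype.card (GL (Fin r) 𝔽 × Matrix (Fin s) (Fin r) 𝔽 × Matrix (Fin r) (Fin s) 𝔽) ≤
      (Finset.univ.filter fun X : Matrix (Fin (r + s)) (Fin (r + s)) 𝔽 => X.rank = r).card := by
    rw [← Fintype.card_subtype]
    refine Fintype.card_le_of_injective (fun x =>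
      ⟨(g x).submatrix finSumFinEquiv.symm finSumFinEquiv.symm, ?_⟩) fun x y h => hg ?_
    · rw [Matrix.rank_submatrix, hrank]
    · have h' := congrArg (fun M => Matrix.submatrix M finSumFinEquiv finSumFinEquiv)
        (congrArg Subtype.val h)
      simpa using h'
  rw [Fintype.card_prod, Fintype.card_prod, Fintype.card_matrix_fin, Fintype.card_matrix_fin, ← Nat.card_eq_fintype_card]
    at hcard
  have hcard' : (Nat.card (GL (Fin r) 𝔽) : ℝ) *
      ((Fintype.card 𝔽 : ℝ) ^ (s * r) * (Fintype.card 𝔽 : ℝ) ^ (r * s)) ≤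
      (Finset.univ.filter fun X : Matrix (Fin (r + s)) (Fin (r + s)) 𝔽 => X.rank = r).card := by
    exact_mod_cast hcard
  have hGL := card_pow_sq_le_card_GL (𝔽 := 𝔽) r
  set q : ℝ := (Fintype.card 𝔽 : ℝ)
  have hq0 : 0 ≤ q := Nat.cast_nonneg _
  calc q ^ (r + s) ^ 2 = q ^ (r ^ 2) * (q ^ (s * r) * q ^ (r * s)) * q ^ (s ^ 2) := by
        rw [← pow_add, ← pow_add, ← pow_add]
        congr 1
        ring
    _ ≤ (4 * Nat.card (GL (Fin r) 𝔽)) * (q ^ (s * r) * q ^ (r * s)) * q ^ (s ^ 2) := by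
        gcongr
    _ = 4 * (Nat.card (GL (Fin r) 𝔽) * (q ^ (s * r) * q ^ (r * s))) * q ^ (s ^ 2) := by ring
    _ ≤ _ := by
        rw [Nat.add_sub_cancel_left]
        gcongr

/-- Rescaling one row brings an invertible matrix to determinant `t`; together with the original
determinant the result recovers the matrix. -/
theorem card_pow_le_card_det_eq {n : ℕ} (hn : 0 < n) {t : 𝔽} (ht : t ≠ 0) :
    (Fintype.card 𝔽 : ℝ) ^ (n ^ 2) ≤ 4 *
      (Finset.univ.filter fun X : Matrix (Fin n) (Fin n) 𝔽 => X.det = t).card *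
        (Fintype.card 𝔽 : ℝ) := by
  refine (card_pow_sq_le_card_GL n).trans ?_
  rw [mul_assoc]
  refine mul_le_mul_of_nonneg_left ?_ (by norm_num)
  have h : Nat.card (GL (Fin n) 𝔽) ≤
      (Finset.univ.filter fun X : Matrix (Fin n) (Fin n) 𝔽 => X.det = t).card *
        Fintype.card 𝔽 := by
    rw [← Fintype.card_subtype, ← Fintype.card_prod, Nat.card_eq_fintype_card]
    let d : 𝔽 → Matrix (Fin n) (Fin n) 𝔽 := fun a =>
      Matrix.diagonal (Function.update 1 ⟨0, hn⟩ a)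
    have hd : ∀ a, (d a).det = a := by
      intro a
      rw [Matrix.det_diagonal, Finset.prod_update_of_mem (Finset.mem_univ _)]
      simp
    refine Fintype.card_le_of_injective (fun A =>
      (⟨d (t * (A.1.det)⁻¹) * A.1, ?_⟩, A.1.det)) ?_
    · have h0 : A.1.det ≠ 0 := ((Matrix.isUnit_iff_isUnit_det _).1 A.isUnit).ne_zero
      rw [Matrix.det_mul, hd, mul_assoc, inv_mul_cancel₀ h0, mul_one]
    · intro A B hAB
      obtain ⟨h1, h2⟩ := Prod.mk.inj hAB
      have h0 : A.1.det ≠ 0 := ((Matrix.isUnit_iff_isUnit_det _).1 A.isUnit).ne_zero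
      have h1' := congrArg Subtype.val h1
      simp only [← h2] at h1'
      have hu : IsUnit (d (t * (A.1.det)⁻¹)) := by
        rw [Matrix.isUnit_iff_isUnit_det, hd]
        exact IsUnit.mk0 _ (mul_ne_zero ht (inv_ne_zero h0))
      exact Units.ext (hu.mul_right_injective h1')
  exact_mod_cast h

/-- The Fourier coefficients of an invariant function at matrices of rank above `m`. -/
theorem IsSLInvariant.norm_sq_matrixFourier_le {n : ℕ} {φ : Matrix (Fin n) (Fin n) 𝔽 → ℂ}
    (hφ : IsSLInvariant φ) {m e : ℕ} (he : 0 < e) (hm : n ≤ m + 1 + e)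
    {M : Matrix (Fin n) (Fin n) 𝔽} (hM : m < M.rank) :
    ‖_root_.matrixFourier φ M‖ ^ 2 ≤
      4 * (Fintype.card 𝔽 : ℝ) ^ (e ^ 2) * ∑ X, ‖φ X‖ ^ 2 := by
  have hq1 : (1 : ℝ) ≤ Fintype.card 𝔽 := by exact_mod_cast Fintype.card_pos
  set q : ℝ := (Fintype.card 𝔽 : ℝ) with hq
  have hN : (Fintype.card (Matrix (Fin n) (Fin n) 𝔽) : ℝ) = q ^ n ^ 2 := by
    rw [Fintype.card_matrix_fin, ← pow_two]
    push_cast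
    rfl
  set T := ‖_root_.matrixFourier φ M‖ ^ 2
  set σ := ∑ X, ‖φ X‖ ^ 2
  have hT : 0 ≤ T := by positivity
  have hσ : 0 ≤ σ := by positivity
  have hpos : 0 < q ^ n ^ 2 := by positivity
  have main : ∀ c : ℝ, T * c ≤ q ^ n ^ 2 * σ → q ^ n ^ 2 ≤ 4 * c * q ^ (e ^ 2) →
      T ≤ 4 * q ^ (e ^ 2) * σ := by
    intro c h1 h2
    have h3 : q ^ n ^ 2 * T ≤ q ^ n ^ 2 * (4 * q ^ (e ^ 2) * σ) := by
      calc q ^ n ^ 2 * T ≤ 4 * c * q ^ (e ^ 2) * T := by gcongr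
        _ = 4 * q ^ (e ^ 2) * (T * c) := by ring
        _ ≤ 4 * q ^ (e ^ 2) * (q ^ n ^ 2 * σ) := by gcongr
        _ = _ := by ring
    exact le_of_mul_le_mul_left h3 hpos
  by_cases hdet : M.det = 0
  · have hlt := Matrix.det_eq_zero_iff_rank_lt.1 hdet
    have h1 := hφ.norm_sq_matrixFourier_mul_card_rank hlt
    rw [hN] at h1
    refine main _ h1 ((card_pow_le_card_rank_eq hlt.le).trans ?_)
    gcongr
    omega
  · have h1 := hφ.norm_sq_matrixFourier_mul_card_det hdet
    rw [hN] at h1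
    have hn : 0 < n := by
      have := M.rank_le_width
      omega
    refine main _ h1 ((card_pow_le_card_det_eq hn hdet).trans ?_)
    gcongr
    -- A determinant class loses only a factor `q`, absorbed in `q ^ (e ^ 2)` because `e` is
    -- positive.
    exact le_self_pow₀ hq1 (by positivity)

end Counting

/-! ### Divided-difference weights at powers of `q`. -/

section LagrangeWeights

theorem one_fourth_le_prod_one_sub_pow_comp {x : ℝ} (hx0 : 0 ≤ x) (hx : x ≤ 1 / 2) (s : Finset ℕ)
    (g : ℕ → ℕ) (hg : Set.InjOn g s) (hpos : ∀ j ∈ s, 0 < g j) :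
    1 / 4 ≤ ∏ j ∈ s, (1 - x ^ g j) := by
  have hinj : Set.InjOn (fun j => g j - 1) s := by
    intro a ha b hb hab
    have h1 := hpos a ha
    have h2 := hpos b hb
    exact hg ha hb (by simp only at hab; omega)
  have h1 : ∏ j ∈ s, (1 - x ^ g j) = ∏ k ∈ s.image fun j => g j - 1, (1 - x ^ (k + 1)) := by
    rw [Finset.prod_image hinj]
    refine Finset.prod_congr rfl fun j hj => ?_
    rw [Nat.sub_add_cancel (hpos j hj)]
  obtain ⟨N, hN⟩ := (s.image fun j => g j - 1).exists_nat_subset_range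
  have h2 := one_fourth_le_prod_one_sub_pow hx0 hx N
  rw [← Finset.prod_sdiff hN] at h2
  rw [h1]
  have hterm : ∀ k : ℕ, 0 ≤ 1 - x ^ (k + 1) ∧ 1 - x ^ (k + 1) ≤ 1 := by
    intro k
    have h3 : x ^ (k + 1) ≤ 1 := pow_le_one₀ hx0 (by linarith)
    have h4 : 0 ≤ x ^ (k + 1) := by positivity
    constructor <;> linarith
  refine h2.trans (mul_le_of_le_one_left (Finset.prod_nonneg fun k _ => (hterm k).1) ?_)
  exact Finset.prod_le_one (fun k _ => (hterm k).1) fun k _ => (hterm k).2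

theorem inv_one_sub_inv_eq {x : ℝ} (hx : x ≠ 0) : (1 - x⁻¹)⁻¹ = x / (x - 1) := by
  rw [← inv_div, sub_div, div_self hx, one_div]

/-- The exponents of the interpolation nodes `q ^ i`: the numbers `0` and `1` and those
from `l` to `n`. -/
def nodeSet (l n : ℕ) : Finset ℕ := insert 0 (insert 1 (Finset.Icc l n))

/-- The coefficients of the divided difference at the nodes `q ^ i`, normalized so that those at
`0` and `1` have absolute value about `1`. -/
noncomputable def lagrangeWeight (q : ℝ) (l n i : ℕ) : ℝ :=
  if i ∈ nodeSet l n then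
    ((1 - q) * ∏ j ∈ Finset.Icc l n, -q ^ j) / ∏ j ∈ (nodeSet l n).erase i, (q ^ i - q ^ j)
  else 0

variable {q : ℝ} {l n : ℕ}

theorem card_nodeSet (hl : 3 ≤ l) : (nodeSet l n).card = n + 1 - l + 2 := by
  rw [nodeSet, Finset.card_insert_of_notMem, Finset.card_insert_of_notMem, Nat.card_Icc]
  · simp; omega
  · simp; omega

/-- Up to normalization, the sum is the top interpolation coefficient of `X ^ j` at the nodes `q ^
i`. Its index is one more than `n + 1 - l`, hence larger than `j`. -/
theorem sum_lagrangeWeight_mul_pow (hq : 2 ≤ q) (hl : 3 ≤ l) {j : ℕ} (hj : j ≤ n + 1 - l) :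
    ∑ i ∈ nodeSet l n, lagrangeWeight q l n i * q ^ (j * i) = 0 := by
  have hinj : Set.InjOn (fun i : ℕ => q ^ i) (nodeSet l n) :=
    (pow_right_injective₀ (by linarith) (by linarith)).injOn
  have hcard := card_nodeSet (n := n) hl
  have hdeg : (Polynomial.X ^ j : Polynomial ℝ).degree < (nodeSet l n).card := by
    rw [Polynomial.degree_X_pow, hcard]
    exact_mod_cast (by omega : j < n + 1 - l + 2)
  have h := Lagrange.coeff_eq_sum hinj hdeg
  rw [Polynomial.coeff_X_pow, if_neg (by omega)] at h
  have h' := congrArg (((1 - q) * ∏ j ∈ Finset.Icc l n, -q ^ j) * ·) h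
  simp only [mul_zero, Finset.mul_sum] at h'
  rw [h']
  refine Finset.sum_congr rfl fun i hi => ?_
  rw [lagrangeWeight, if_pos hi, Polynomial.eval_pow, Polynomial.eval_X, ← pow_mul, mul_comm j]
  ring

theorem one_sub_inv_pow (hq : 2 ≤ q) (k : ℕ) : 0 < 1 - (q⁻¹) ^ (k + 1) := by
  have : (q⁻¹) ^ (k + 1) ≤ q⁻¹ := pow_le_of_le_one (by positivity)
    (inv_le_one_of_one_le₀ (by linarith)) (by omega)
  have h2 : q⁻¹ ≤ 1 / 2 := by
    rw [one_div]
    exact inv_anti₀ (by norm_num) hq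
  linarith

theorem prod_inv_one_sub_bounds (hq : 2 ≤ q) (s : Finset ℕ) (g : ℕ → ℕ) (hg : Set.InjOn g s)
    (hpos : ∀ j ∈ s, 0 < g j) :
    1 ≤ ∏ j ∈ s, (1 - (q⁻¹) ^ g j)⁻¹ ∧ ∏ j ∈ s, (1 - (q⁻¹) ^ g j)⁻¹ ≤ 4 := by
  have h2 : q⁻¹ ≤ 1 / 2 := by
    rw [one_div]
    exact inv_anti₀ (by norm_num) hq
  have hq0 : 0 ≤ q⁻¹ := by positivity
  have h := one_fourth_le_prod_one_sub_pow_comp hq0 h2 s g hg hpos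
  have hle : ∏ j ∈ s, (1 - (q⁻¹) ^ g j) ≤ 1 := by
    refine Finset.prod_le_one (fun j hj => ?_) fun j _ => ?_
    · have := one_sub_inv_pow hq (g j - 1)
      rw [Nat.sub_add_cancel (hpos j hj)] at this
      exact this.le
    · have : 0 ≤ (q⁻¹) ^ g j := by positivity
      linarith
  rw [Finset.prod_inv_distrib]
  refine ⟨(one_le_inv₀ (by linarith)).2 hle, ?_⟩
  calc _ ≤ (1 / 4 : ℝ)⁻¹ := inv_anti₀ (by norm_num) h
    _ = 4 := by norm_num

theorem lagrangeWeight_zero (hq : 2 ≤ q) (hl : 3 ≤ l) :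
    lagrangeWeight q l n 0 = ∏ j ∈ Finset.Icc l n, (1 - (q⁻¹) ^ j)⁻¹ := by
  have he : (nodeSet l n).erase 0 = insert 1 (Finset.Icc l n) := by
    rw [nodeSet, Finset.erase_insert]
    simp; omega
  rw [lagrangeWeight, if_pos (by simp [nodeSet]), he, Finset.prod_insert (by simp; omega),
    pow_zero, pow_one, mul_div_mul_left _ _ (by linarith), ← Finset.prod_div_distrib]
  refine Finset.prod_congr rfl fun j hj => ?_
  have hj' := Finset.mem_Icc.1 hj
  have h1 : 1 < q ^ j := one_lt_pow₀ (by linarith) (by omega)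
  have h2 : 1 - q ^ j ≠ 0 := by linarith
  have h3 : q ^ j - 1 ≠ 0 := by linarith
  have h4 : q ^ j ≠ 0 := by positivity
  rw [inv_pow, inv_one_sub_inv_eq h4, div_eq_div_iff h2 h3]
  ring

theorem lagrangeWeight_one (hq : 2 ≤ q) (hl : 3 ≤ l) :
    lagrangeWeight q l n 1 = -∏ j ∈ Finset.Icc l n, (1 - (q⁻¹) ^ (j - 1))⁻¹ := by
  have he : (nodeSet l n).erase 1 = insert 0 (Finset.Icc l n) := by
    rw [nodeSet, Finset.insert_comm, Finset.erase_insert]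
    simp; omega
  rw [lagrangeWeight, if_pos (by simp [nodeSet]), he, Finset.prod_insert (by simp; omega),
    pow_zero, pow_one, ← neg_sub q 1, neg_mul, neg_div, mul_div_mul_left _ _ (by linarith),
    ← Finset.prod_div_distrib]
  congr 1
  refine Finset.prod_congr rfl fun j hj => ?_
  obtain ⟨k, rfl⟩ : ∃ k, j = k + 2 := ⟨j - 2, by have := Finset.mem_Icc.1 hj; omega⟩
  have h1 : 1 < q ^ (k + 1) := one_lt_pow₀ (by linarith) (by omega)
  have h3 : q ^ (k + 1) - 1 ≠ 0 := by linarith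
  have h4 : q ^ (k + 1) ≠ 0 := by positivity
  have h5 : q ^ (k + 2) = q * q ^ (k + 1) := by ring
  have h2 : q - q ^ (k + 2) ≠ 0 := by
    rw [h5]
    nlinarith
  rw [show k + 2 - 1 = k + 1 from rfl, inv_pow, inv_one_sub_inv_eq h4, div_eq_div_iff h2 h3, h5]
  ring

theorem lagrangeWeight_zero_bounds (hq : 2 ≤ q) (hl : 3 ≤ l) :
    1 ≤ lagrangeWeight q l n 0 ∧ lagrangeWeight q l n 0 ≤ 4 := by
  rw [lagrangeWeight_zero hq hl]
  refine prod_inv_one_sub_bounds hq _ _ Function.injective_id.injOn fun j hj => ?_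
  have := Finset.mem_Icc.1 hj
  omega

theorem lagrangeWeight_one_bounds (hq : 2 ≤ q) (hl : 3 ≤ l) :
    lagrangeWeight q l n 1 ≤ -1 ∧ -4 ≤ lagrangeWeight q l n 1 := by
  rw [lagrangeWeight_one hq hl]
  have := prod_inv_one_sub_bounds hq (Finset.Icc l n) (fun j => j - 1)
    (fun a ha b hb hab => by
      simp only [Finset.coe_Icc, Set.mem_Icc] at ha hb hab
      omega) (fun j hj => by
      have := Finset.mem_Icc.1 hj
      omega)
  constructor <;> linarith

/-- Nodes below `i` contribute decay `q ^ (-(i - j))` each and nodes above contribute about one. The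
factors `(1 - q⁻ᵏ)⁻¹` multiply to at most `4` on each side; the nodes `0` and `1` cost another `4`.
-/
theorem abs_lagrangeWeight_le (hq : 2 ≤ q) (hl : 3 ≤ l) {i : ℕ} (hi : i ∈ Finset.Icc l n) :
    |lagrangeWeight q l n i| ≤
      64 * (q * (q⁻¹) ^ i) * (q⁻¹) ^ (∑ j ∈ Finset.Ico l i, (i - j)) := by
  obtain ⟨hli, hin⟩ := Finset.mem_Icc.1 hi
  have hq0 : 0 < q := by linarith
  have he : (nodeSet l n).erase i = insert 0 (insert 1 ((Finset.Icc l n).erase i)) := by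
    rw [nodeSet, Finset.erase_insert_of_ne (by omega), Finset.erase_insert_of_ne (by omega)]
  have hsplit : (Finset.Icc l n).erase i = Finset.Ico l i ∪ Finset.Ioc i n := by
    ext j
    simp only [Finset.mem_erase, Finset.mem_Icc, Finset.mem_union, Finset.mem_Ico, Finset.mem_Ioc]
    omega
  have hdisj : Disjoint (Finset.Ico l i) (Finset.Ioc i n) := by
    rw [Finset.disjoint_left]
    intro j h1 h2
    simp only [Finset.mem_Ico, Finset.mem_Ioc] at h1 h2
    omega
  have hform : lagrangeWeight q l n i = ((1 - q) * -q ^ i / ((q ^ i - 1) * (q ^ i - q))) *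
      ((∏ j ∈ Finset.Ico l i, -q ^ j / (q ^ i - q ^ j)) *
        ∏ j ∈ Finset.Ioc i n, -q ^ j / (q ^ i - q ^ j)) := by
    rw [lagrangeWeight, if_pos (by simp only [nodeSet, Finset.mem_insert, hi, or_true]), he,
      Finset.prod_insert (by simp; omega), Finset.prod_insert (by simp; omega), pow_zero, pow_one,
      ← Finset.prod_union hdisj, ← hsplit, Finset.prod_div_distrib,
      ← Finset.mul_prod_erase _ _ hi, div_mul_div_comm]
    ring
  have h1 : |(1 - q) * -q ^ i / ((q ^ i - 1) * (q ^ i - q))| ≤ 4 * (q * (q⁻¹) ^ i) := by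
    obtain ⟨k, rfl⟩ : ∃ k, i = k + 2 := ⟨i - 2, by omega⟩
    have h2 : 2 ≤ q ^ (k + 1) := hq.trans (le_self_pow₀ (by linarith) (by omega))
    have h3 : q ^ (k + 2) = q * q ^ (k + 1) := by ring
    have h4 : q ^ (k + 2) / 2 ≤ q ^ (k + 2) - 1 := by rw [h3]; nlinarith
    have h5 : q ^ (k + 2) / 2 ≤ q ^ (k + 2) - q := by rw [h3]; nlinarith
    have h6 : 0 < q ^ (k + 2) := by positivity
    have h7 : 0 < (q ^ (k + 2) - 1) * (q ^ (k + 2) - q) :=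
      mul_pos (by linarith) (by linarith)
    rw [abs_of_nonneg (div_nonneg (by nlinarith) h7.le), div_le_iff₀ h7, inv_pow]
    calc (1 - q) * -q ^ (k + 2) = (q - 1) * q ^ (k + 2) := by ring
      _ ≤ q * q ^ (k + 2) := by nlinarith
      _ = 4 * (q * (q ^ (k + 2))⁻¹) * ((q ^ (k + 2) / 2) * (q ^ (k + 2) / 2)) := by
        field_simp
        norm_num
      _ ≤ _ := by
        refine mul_le_mul_of_nonneg_left ?_ (by positivity)
        exact mul_le_mul h4 h5 (by positivity) (by linarith)
  have h2 : |∏ j ∈ Finset.Ico l i, -q ^ j / (q ^ i - q ^ j)| ≤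
      4 * (q⁻¹) ^ (∑ j ∈ Finset.Ico l i, (i - j)) := by
    have hb := (prod_inv_one_sub_bounds hq (Finset.Ico l i) (fun j => i - j)
      (fun a ha b hb hab => by
        simp only [Finset.coe_Ico, Set.mem_Ico] at ha hb hab
        omega) (fun j hj => by
        have := Finset.mem_Ico.1 hj
        omega)).2
    rw [Finset.abs_prod, ← Finset.prod_pow_eq_pow_sum]
    calc _ = (∏ j ∈ Finset.Ico l i, (1 - (q⁻¹) ^ (i - j))⁻¹) *
          ∏ j ∈ Finset.Ico l i, (q⁻¹) ^ (i - j) := by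
          rw [← Finset.prod_mul_distrib]
          refine Finset.prod_congr rfl fun j hj => ?_
          obtain ⟨k, rfl⟩ : ∃ k, i = j + (k + 1) :=
            ⟨i - j - 1, by have := Finset.mem_Ico.1 hj; omega⟩
          have h3 : 1 < q ^ (k + 1) := one_lt_pow₀ (by linarith) (by omega)
          have h4 : 0 < q ^ j := by positivity
          have h5 : q ^ (k + 1) - 1 ≠ 0 := by linarith
          rw [Nat.add_sub_cancel_left, pow_add, abs_div, abs_neg, abs_of_pos h4,
            abs_of_pos (by nlinarith), inv_pow, inv_one_sub_inv_eq (by positivity)]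
          rw [show q ^ j * q ^ (k + 1) - q ^ j = q ^ j * (q ^ (k + 1) - 1) by ring]
          field_simp
      _ ≤ _ := mul_le_mul_of_nonneg_right hb (Finset.prod_nonneg fun j _ => by positivity)
  have h3 : |∏ j ∈ Finset.Ioc i n, -q ^ j / (q ^ i - q ^ j)| ≤ 4 := by
    have hb := (prod_inv_one_sub_bounds hq (Finset.Ioc i n) (fun j => j - i)
      (fun a ha b hb hab => by
        simp only [Finset.coe_Ioc, Set.mem_Ioc] at ha hb hab
        omega) (fun j hj => by
        have := Finset.mem_Ioc.1 hj
        omega)).2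
    refine le_trans (le_of_eq ?_) hb
    rw [Finset.abs_prod]
    refine Finset.prod_congr rfl fun j hj => ?_
    obtain ⟨k, rfl⟩ : ∃ k, j = i + (k + 1) :=
      ⟨j - i - 1, by have := Finset.mem_Ioc.1 hj; omega⟩
    have h3 : 1 < q ^ (k + 1) := one_lt_pow₀ (by linarith) (by omega)
    have h4 : 0 < q ^ i := by positivity
    have h5 : q ^ (k + 1) - 1 ≠ 0 := by linarith
    rw [Nat.add_sub_cancel_left, abs_div, abs_neg, abs_of_pos (by positivity),
      abs_of_neg (by rw [pow_add]; nlinarith), inv_pow, inv_one_sub_inv_eq (by positivity), pow_add,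
      show -(q ^ i - q ^ i * q ^ (k + 1)) = q ^ i * (q ^ (k + 1) - 1) by ring]
    field_simp
  rw [hform, abs_mul, abs_mul]
  calc _ ≤ (4 * (q * (q⁻¹) ^ i)) *
        ((4 * (q⁻¹) ^ (∑ j ∈ Finset.Ico l i, (i - j))) * 4) := by
        gcongr
    _ = _ := by ring

theorem sum_abs_lagrangeWeight_le (hq : 2 ≤ q) (hl : 3 ≤ l) :
    ∑ i ∈ Finset.Icc l n, |lagrangeWeight q l n i| ≤ 128 * (q * (q⁻¹) ^ l) := by
  have hq0 : 0 < q := by linarith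
  have hx0 : 0 ≤ q⁻¹ := by positivity
  have hx2 : q⁻¹ ≤ 1 / 2 := by
    rw [one_div]
    exact inv_anti₀ (by norm_num) hq
  calc _ ≤ ∑ i ∈ Finset.Ico l (n + 1), 64 * q * (q⁻¹) ^ i := by
        rw [Finset.Ico_add_one_right_eq_Icc]
        refine Finset.sum_le_sum fun i hi => (abs_lagrangeWeight_le hq hl hi).trans ?_
        rw [← mul_assoc]
        exact mul_le_of_le_one_right (by positivity) (pow_le_one₀ hx0 (by linarith))
    _ = 64 * q * ∑ i ∈ Finset.Ico l (n + 1), (q⁻¹) ^ i := by rw [Finset.mul_sum]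
    _ ≤ 64 * q * ((q⁻¹) ^ l / (1 - q⁻¹)) := by
        gcongr
        exact geom_sum_Ico_le_of_lt_one hx0 (by linarith)
    _ ≤ 64 * q * ((q⁻¹) ^ l * 2) := by
        gcongr
        rw [div_le_iff₀ (by linarith)]
        have : 0 ≤ (q⁻¹) ^ l := by positivity
        nlinarith
    _ = _ := by ring

theorem sq_sub_le_two_mul_sum (l i : ℕ) : (i - l) ^ 2 ≤ 2 * ∑ j ∈ Finset.Ico l i, (i - j) := by
  rcases le_total l i with h | h
  · obtain ⟨d, rfl⟩ := Nat.exists_eq_add_of_le h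
    rw [Nat.add_sub_cancel_left]
    have h1 : ∑ j ∈ Finset.Ico l (l + d), (l + d - j) = ∑ k ∈ Finset.range d, (k + 1) := by
      rw [Finset.sum_Ico_eq_sum_range, Nat.add_sub_cancel_left, ← Finset.sum_range_reflect]
      refine Finset.sum_congr rfl fun k hk => ?_
      have := Finset.mem_range.1 hk
      omega
    rw [h1]
    clear h1 h
    induction d with
    | zero => simp
    | succ d ih =>
      rw [Finset.sum_range_succ]
      nlinarith
  · simp [Nat.sub_eq_zero_of_le h]

/-- The square of the weight decays at least like `q ^ (-(i - l) ^ 2)`, which cancels the growth `q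
^ (i ^ 2)` of the inverse class size. What remains is `q ^ (2 * i * l - l ^ 2)`, and `i ≤ n`. -/
theorem sq_lagrangeWeight_mul_le (hq : 2 ≤ q) (hl : 3 ≤ l) {i : ℕ} (hi : i ∈ Finset.Icc l n) :
    lagrangeWeight q l n i ^ 2 * q ^ (i ^ 2) * q ^ (l ^ 2) ≤ 4096 * q ^ (2 * n * l) := by
  obtain ⟨hli, hin⟩ := Finset.mem_Icc.1 hi
  have hq0 : 0 < q := by linarith
  have hx0 : 0 ≤ q⁻¹ := by positivity
  have hx1 : q⁻¹ ≤ 1 := inv_le_one_of_one_le₀ (by linarith)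
  set T := ∑ j ∈ Finset.Ico l i, (i - j) with hT
  have h1 : |lagrangeWeight q l n i| ≤ 64 * (q⁻¹) ^ T := by
    refine (abs_lagrangeWeight_le hq hl hi).trans ?_
    rw [← hT]
    refine mul_le_mul_of_nonneg_right ?_ (by positivity)
    have : (q⁻¹) ^ i ≤ q⁻¹ := pow_le_of_le_one hx0 hx1 (by omega)
    have h3 : q * (q⁻¹) ^ i ≤ 1 := by
      calc q * (q⁻¹) ^ i ≤ q * q⁻¹ := by gcongr
        _ = 1 := mul_inv_cancel₀ hq0.ne'
    linarith
  have h2 : i ^ 2 + l ^ 2 ≤ 2 * T + 2 * n * l := by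
    have h3 := sq_sub_le_two_mul_sum l i
    rw [← hT] at h3
    obtain ⟨d, rfl⟩ := Nat.exists_eq_add_of_le hli
    rw [Nat.add_sub_cancel_left] at h3
    nlinarith
  calc _ = |lagrangeWeight q l n i| ^ 2 * q ^ (i ^ 2 + l ^ 2) := by rw [sq_abs, pow_add]; ring
    _ ≤ (64 * (q⁻¹) ^ T) ^ 2 * q ^ (2 * T + 2 * n * l) := by
      gcongr
      linarith
    _ = 4096 * q ^ (2 * n * l) * ((q⁻¹) ^ T * q ^ T) ^ 2 := by
      rw [pow_add, pow_mul q 2 T, ← pow_mul, mul_comm 2 T, pow_mul]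
      ring
    _ = _ := by rw [← mul_pow, inv_mul_cancel₀ hq0.ne']; simp

end LagrangeWeights

/-! ### Test weights on determinant and corank classes, and the resulting cost inequalities. -/

section DetRankWeight

variable {𝔽 : Type*} [Field 𝔽] [Fintype 𝔽] [DecidableEq 𝔽] {n : ℕ}

theorem sum_det_rank {t : 𝔽} (ht : t ≠ 0) (α : ℝ) (β : ℕ → ℝ) :
    ∑ X : Matrix (Fin n) (Fin n) 𝔽,
        (if X.det = t then α else if X.det = 0 then β (n - X.rank) else 0) =
      (Finset.univ.filter fun X : Matrix (Fin n) (Fin n) 𝔽 => X.det = t).card * α +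
        ∑ i ∈ Finset.Icc 1 n,
          (Finset.univ.filter fun X : Matrix (Fin n) (Fin n) 𝔽 => X.rank = n - i).card * β i := by
  have h : ∀ X : Matrix (Fin n) (Fin n) 𝔽,
      (if X.det = t then α else if X.det = 0 then β (n - X.rank) else 0) =
        (if X.det = t then α else 0) + ∑ i ∈ Finset.Icc 1 n,
          if X.rank = n - i then β i else 0 := by
    intro X
    have hle := X.rank_le_width
    have hiff := Matrix.det_eq_zero_iff_rank_lt (M := X)
    by_cases h0 : X.det = 0
    · have hlt := hiff.1 h0
      rw [h0, if_neg ht.symm, if_pos rfl, if_neg ht.symm, zero_add,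
        Finset.sum_eq_single_of_mem (n - X.rank) (Finset.mem_Icc.2 (by omega))]
      · rw [if_pos (by omega)]
      · intro i hi hne
        have := Finset.mem_Icc.1 hi
        exact if_neg (by omega)
    · have hge : ¬ X.rank < n := fun h => h0 (hiff.2 h)
      rw [if_neg h0, Finset.sum_eq_zero, add_zero]
      intro i hi
      have := Finset.mem_Icc.1 hi
      exact if_neg (by omega)
  simp only [h, Finset.sum_add_distrib]
  rw [Finset.sum_comm]
  simp only [← Finset.sum_filter, Finset.sum_const, nsmul_eq_mul]

theorem card_det_eq_pos (hn : 0 < n) {t : 𝔽} (ht : t ≠ 0) :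
    (0 : ℝ) < (Finset.univ.filter fun X : Matrix (Fin n) (Fin n) 𝔽 => X.det = t).card := by
  have hq : (0 : ℝ) < Fintype.card 𝔽 := by exact_mod_cast Fintype.card_pos
  have h := card_pow_le_card_det_eq hn ht
  have h1 : (0 : ℝ) < (Fintype.card 𝔽 : ℝ) ^ (n ^ 2) := by positivity
  by_contra hcon
  have h2 := le_antisymm (not_lt.1 hcon) (Nat.cast_nonneg _)
  rw [h2] at h
  linarith

theorem card_rank_eq_pos {r : ℕ} (hr : r ≤ n) :
    (0 : ℝ) < (Finset.univ.filter fun X : Matrix (Fin n) (Fin n) 𝔽 => X.rank = r).card := by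
  have hq : (0 : ℝ) < Fintype.card 𝔽 := by exact_mod_cast Fintype.card_pos
  have h := card_pow_le_card_rank_eq (𝔽 := 𝔽) hr
  have h1 : (0 : ℝ) < (Fintype.card 𝔽 : ℝ) ^ (n ^ 2) := by positivity
  by_contra hcon
  have h2 := le_antisymm (not_lt.1 hcon) (Nat.cast_nonneg _)
  rw [h2] at h
  linarith

theorem inv_card_det_eq_le (hn : 0 < n) {t : 𝔽} (ht : t ≠ 0) :
    (((Finset.univ.filter fun X : Matrix (Fin n) (Fin n) 𝔽 => X.det = t).card : ℝ))⁻¹ ≤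
      4 * Fintype.card 𝔽 / (Fintype.card 𝔽 : ℝ) ^ (n ^ 2) := by
  have hq : (0 : ℝ) < Fintype.card 𝔽 := by exact_mod_cast Fintype.card_pos
  rw [inv_eq_one_div, div_le_div_iff₀ (card_det_eq_pos hn ht) (by positivity), one_mul]
  exact (card_pow_le_card_det_eq hn ht).trans_eq (by ring)

theorem inv_card_rank_eq_le {i : ℕ} (hi : i ≤ n) :
    (((Finset.univ.filter fun X : Matrix (Fin n) (Fin n) 𝔽 => X.rank = n - i).card : ℝ))⁻¹ ≤
      4 * (Fintype.card 𝔽 : ℝ) ^ (i ^ 2) / (Fintype.card 𝔽 : ℝ) ^ (n ^ 2) := by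
  have hq : (0 : ℝ) < Fintype.card 𝔽 := by exact_mod_cast Fintype.card_pos
  rw [inv_eq_one_div, div_le_div_iff₀ (card_rank_eq_pos (by omega)) (by positivity), one_mul]
  refine (card_pow_le_card_rank_eq (by omega : n - i ≤ n)).trans_eq ?_
  rw [Nat.sub_sub_self hi]
  ring

/-- The signed measure of mass `w 0` on the matrices of determinant `t`, and of mass `w i` on the
singular matrices of corank `i`, uniform on each of these sets. -/
noncomputable def detRankWeight (t : 𝔽) (w : ℕ → ℝ) (X : Matrix (Fin n) (Fin n) 𝔽) : ℝ :=
  if X.det = t then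
    w 0 / (Finset.univ.filter fun Y : Matrix (Fin n) (Fin n) 𝔽 => Y.det = t).card
  else if X.det = 0 then
    w (n - X.rank) / (Finset.univ.filter fun Y : Matrix (Fin n) (Fin n) 𝔽 =>
      Y.rank = n - (n - X.rank)).card
  else 0

theorem detRankWeight_isSLInvariant (t : 𝔽) (w : ℕ → ℝ) :
    IsSLInvariant (fun X : Matrix (Fin n) (Fin n) 𝔽 => (detRankWeight t w X : ℂ)) := by
  intro P Q X hP hQ
  have hdet : (P * X * Q).det = X.det := by simp [hP, hQ]
  have hrank : (P * X * Q).rank = X.rank := by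
    rw [Matrix.rank_mul_eq_left_of_isUnit_det _ _ (by rw [hQ]; exact isUnit_one),
      Matrix.rank_mul_eq_right_of_isUnit_det _ _ (by rw [hP]; exact isUnit_one)]
  simp only [detRankWeight, hdet, hrank]

theorem sum_detRankWeight_mul_pow (hn : 0 < n) {t : 𝔽} (ht : t ≠ 0) (w : ℕ → ℝ) (q : ℝ) (j : ℕ) :
    ∑ X : Matrix (Fin n) (Fin n) 𝔽, detRankWeight t w X * q ^ (j * (n - X.rank)) =
      w 0 + ∑ i ∈ Finset.Icc 1 n, w i * q ^ (j * i) := by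
  have hD := (card_det_eq_pos hn ht).ne'
  have h := sum_det_rank (n := n) ht
    (w 0 / (Finset.univ.filter fun Y : Matrix (Fin n) (Fin n) 𝔽 => Y.det = t).card)
    (fun i => w i / (Finset.univ.filter fun Y : Matrix (Fin n) (Fin n) 𝔽 =>
      Y.rank = n - i).card * q ^ (j * i))
  rw [mul_div_cancel₀ _ hD] at h
  rw [Finset.sum_congr rfl fun X _ => ?_, h]
  · congr 1
    refine Finset.sum_congr rfl fun i _ => ?_
    have hN := (card_rank_eq_pos (𝔽 := 𝔽) (Nat.sub_le n i)).ne'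
    rw [← mul_assoc, mul_div_cancel₀ _ hN]
  · unfold detRankWeight
    split_ifs with h1 h2
    · have : ¬ X.rank < n := fun hlt => ht (h1 ▸ Matrix.det_eq_zero_iff_rank_lt.2 hlt)
      rw [Nat.sub_eq_zero_of_le (by omega), mul_zero, pow_zero, mul_one]
    · rfl
    · rw [zero_mul]

theorem sum_sq_detRankWeight_le (hn : 0 < n) {t : 𝔽} (ht : t ≠ 0) (w : ℕ → ℝ) :
    ∑ X : Matrix (Fin n) (Fin n) 𝔽, detRankWeight t w X ^ 2 ≤
      4 * ((Fintype.card 𝔽 : ℝ) * w 0 ^ 2 +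
        ∑ i ∈ Finset.Icc 1 n, w i ^ 2 * (Fintype.card 𝔽 : ℝ) ^ (i ^ 2)) /
          (Fintype.card 𝔽 : ℝ) ^ (n ^ 2) := by
  have hD := (card_det_eq_pos hn ht).ne'
  have h := sum_det_rank (n := n) ht
    ((w 0 / (Finset.univ.filter fun Y : Matrix (Fin n) (Fin n) 𝔽 => Y.det = t).card) ^ 2)
    (fun i => (w i / (Finset.univ.filter fun Y : Matrix (Fin n) (Fin n) 𝔽 =>
      Y.rank = n - i).card) ^ 2)
  rw [Finset.sum_congr rfl fun X _ => ?_, h]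
  · rw [mul_add, add_div, Finset.mul_sum, Finset.sum_div]
    refine add_le_add ?_ (Finset.sum_le_sum fun i hi => ?_)
    · calc _ = w 0 ^ 2 *
            (((Finset.univ.filter fun X : Matrix (Fin n) (Fin n) 𝔽 => X.det = t).card : ℝ))⁻¹ := by
            field_simp
        _ ≤ w 0 ^ 2 * _ := mul_le_mul_of_nonneg_left (inv_card_det_eq_le hn ht) (sq_nonneg _)
        _ = _ := by ring
    · have hN := (card_rank_eq_pos (𝔽 := 𝔽) (Nat.sub_le n i)).ne'
      calc _ = w i ^ 2 * (((Finset.univ.filter fun X : Matrix (Fin n) (Fin n) 𝔽 =>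
              X.rank = n - i).card : ℝ))⁻¹ := by
            field_simp
        _ ≤ w i ^ 2 * _ := mul_le_mul_of_nonneg_left
            (inv_card_rank_eq_le (Finset.mem_Icc.1 hi).2) (sq_nonneg _)
        _ = _ := by ring
  · unfold detRankWeight
    split_ifs <;> simp

theorem sum_abs_detRankWeight (hn : 0 < n) {t : 𝔽} (ht : t ≠ 0) (w : ℕ → ℝ) (p : Prop) [Decidable p]
    (r : ℕ → Prop) [DecidablePred r] (S : Finset (Matrix (Fin n) (Fin n) 𝔽))
    (hS1 : ∀ X : Matrix (Fin n) (Fin n) 𝔽, X.det = t → (X ∈ S ↔ p))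
    (hS2 : ∀ X : Matrix (Fin n) (Fin n) 𝔽, X.det = 0 → (X ∈ S ↔ r (n - X.rank))) :
    ∑ X ∈ S, |detRankWeight t w X| =
      (if p then |w 0| else 0) + ∑ i ∈ Finset.Icc 1 n, if r i then |w i| else 0 := by
  have hD := (card_det_eq_pos hn ht)
  have h := sum_det_rank (n := n) ht
    (if p then |w 0| / (Finset.univ.filter fun Y : Matrix (Fin n) (Fin n) 𝔽 => Y.det = t).card
      else 0)
    (fun i => if r i then |w i| / (Finset.univ.filter fun Y : Matrix (Fin n) (Fin n) 𝔽 =>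
      Y.rank = n - i).card else 0)
  have h1 : ∑ X ∈ S, |detRankWeight t w X| =
      ∑ X, if X ∈ S then |detRankWeight t w X| else 0 := by
    rw [← Finset.sum_filter, Finset.filter_univ_mem]
  rw [h1, Finset.sum_congr rfl fun X _ => ?_, h]
  · congr 1
    · rw [mul_ite, mul_zero, mul_div_cancel₀ _ hD.ne']
    · refine Finset.sum_congr rfl fun i _ => ?_
      have hN := (card_rank_eq_pos (𝔽 := 𝔽) (Nat.sub_le n i)).ne'
      rw [mul_ite, mul_zero, mul_div_cancel₀ _ hN]
  · unfold detRankWeight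
    by_cases h1 : X.det = t
    · simp only [if_pos h1, hS1 X h1, abs_div, Nat.abs_cast]
    · by_cases h2 : X.det = 0
      · simp only [if_neg h1, if_pos h2, hS2 X h2, abs_div, Nat.abs_cast]
      · simp only [if_neg h1, if_neg h2, abs_zero, ite_self]

/-- The lower bound for telling singular matrices from matrices of a given nonzero determinant,
in terms of the parameter `l` of the weight. -/
theorem QuantumProtocol.singular_bound
    (P : QuantumProtocol (Matrix (Fin n) (Fin n) 𝔽) (Matrix (Fin n) (Fin n) 𝔽)) (hn : 2 ≤ n)
    {t : 𝔽} (ht : t ≠ 0) (f : Matrix (Fin n) (Fin n) 𝔽 → Option ℤˣ) (s : ℤˣ)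
    (hft : ∀ X, X.det = t → f X = some s) (hf0 : ∀ X, X.det = 0 → f X = some (-s)) {δ : ℝ}
    (hδ : 0 ≤ δ) (hP : P.HasError (fun A B => f (A + B)) (1 / 2 - δ / 2)) {l : ℕ} (hl : 3 ≤ l)
    (hln : l ≤ n + 1)
    (hW : ∑ i ∈ Finset.Icc l n, |lagrangeWeight (Fintype.card 𝔽) l n i| ≤ δ) :
    δ ^ 2 ≤ 4 * 16 ^ P.cost * (16 * (Fintype.card 𝔽 : ℝ) ^ ((l - 2) ^ 2) *
      (32 * Fintype.card 𝔽 + ∑ i ∈ Finset.Icc l n,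
        lagrangeWeight (Fintype.card 𝔽) l n i ^ 2 * (Fintype.card 𝔽 : ℝ) ^ (i ^ 2)) /
          (Fintype.card 𝔽 : ℝ) ^ (n ^ 2)) := by
  have hq : (2 : ℝ) ≤ Fintype.card 𝔽 := by
    exact_mod_cast (Fintype.one_lt_card : 1 < Fintype.card 𝔽)
  set q : ℝ := (Fintype.card 𝔽 : ℝ) with hqdef
  have hn0 : 0 < n := by omega
  set v : ℕ → ℝ := lagrangeWeight q l n with hv
  -- The sign `s` treats at once the cases where the singular side is `a` or `b`.
  set w : ℕ → ℝ := fun i => ((s : ℤ) : ℝ) * v i with hw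
  have hs2 : ((s : ℤ) : ℝ) ^ 2 = 1 := by
    rcases Int.units_eq_one_or s with rfl | rfl <;> norm_num
  have hsabs : |((s : ℤ) : ℝ)| = 1 := by
    rcases Int.units_eq_one_or s with rfl | rfl <;> norm_num
  have hv0 := lagrangeWeight_zero_bounds (n := n) hq hl
  have hv1 := lagrangeWeight_one_bounds (n := n) hq hl
  rw [← hv] at hv0 hv1
  have hIcc : ∀ g : ℕ → ℝ, (∀ i, i ∉ nodeSet l n → g i = 0) →
      ∑ i ∈ Finset.Icc 1 n, g i = g 1 + ∑ i ∈ Finset.Icc l n, g i := by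
    intro g hg
    rw [← Finset.sum_insert (by simp; omega)]
    symm
    refine Finset.sum_subset (fun i hi => ?_) fun i hi hni => hg i ?_
    · simp only [Finset.mem_insert, Finset.mem_Icc] at hi ⊢
      omega
    · simp only [nodeSet, Finset.mem_insert, Finset.mem_Icc] at hi hni ⊢
      omega
  have hvout : ∀ i, i ∉ nodeSet l n → v i = 0 := fun i hi => if_neg hi
  set φ : Matrix (Fin n) (Fin n) 𝔽 → ℝ := detRankWeight t w with hφ
  have hmom : ∀ j ≤ n + 1 - l, ∑ X, φ X * q ^ (j * (n - X.rank)) = 0 := by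
    intro j hj
    have h := sum_lagrangeWeight_mul_pow (n := n) hq hl hj
    rw [hφ, sum_detRankWeight_mul_pow hn0 ht, hIcc _ fun i hi => by simp [hw, hvout i hi]]
    rw [nodeSet, Finset.sum_insert (by simp; omega), Finset.sum_insert (by simp; omega),
      mul_zero, pow_zero, mul_one] at h
    have h' := congrArg (((s : ℤ) : ℝ) * ·) h
    simp only [mul_add, Finset.mul_sum, mul_zero] at h'
    simpa only [hw, mul_assoc] using h'
  have hsq : ∑ X, φ X ^ 2 ≤ 4 * (32 * q + ∑ i ∈ Finset.Icc l n, v i ^ 2 * q ^ (i ^ 2)) /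
      q ^ (n ^ 2) := by
    refine (sum_sq_detRankWeight_le hn0 ht w).trans ?_
    rw [← hqdef, hIcc _ fun i hi => by simp [hw, hvout i hi]]
    simp only [hw, mul_pow, hs2, one_mul, one_pow, pow_one]
    -- Nodes `0` and `1` contribute at most `16 * q` each, hence `32 * q`.
    have h0 : v 0 ^ 2 ≤ 16 := by nlinarith
    have h1 : v 1 ^ 2 ≤ 16 := by nlinarith
    have hq0 : 0 < q := by linarith
    gcongr 4 * ?_ / _
    nlinarith
  set B : ℝ := 16 * q ^ ((l - 2) ^ 2) *
    (32 * q + ∑ i ∈ Finset.Icc l n, v i ^ 2 * q ^ (i ^ 2)) / q ^ (n ^ 2) with hB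
  have hinv := detRankWeight_isSLInvariant (n := n) t w
  rw [← hφ] at hinv
  have hFT : ∀ M, ‖matrixFourier (fun X => (φ X : ℂ)) M‖ ≤ √B := by
    intro M
    by_cases hM : M.rank ≤ n + 1 - l
    · rw [hinv.matrixFourier_eq_zero (m := n + 1 - l) (by omega) (fun j hj => ?_) M hM, norm_zero]
      · exact Real.sqrt_nonneg _
      · have h1 := congrArg ((↑) : ℝ → ℂ) (hmom j hj)
        simpa only [hqdef, Complex.ofReal_sum, Complex.ofReal_mul, Complex.ofReal_pow,
          Complex.ofReal_natCast, Complex.ofReal_zero] using h1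
    · refine Real.le_sqrt_of_sq_le ?_
      -- Rank above `n + 1 - l` means corank at most `l - 2`.
      refine (hinv.norm_sq_matrixFourier_le (m := n + 1 - l) (e := l - 2) (by omega) (by omega)
        (by omega)).trans ?_
      simp only [Complex.norm_real, Real.norm_eq_abs, sq_abs]
      calc _ ≤ 4 * q ^ ((l - 2) ^ 2) *
            (4 * (32 * q + ∑ i ∈ Finset.Icc l n, v i ^ 2 * q ^ (i ^ 2)) / q ^ (n ^ 2)) := by
            gcongr
        _ = B := by rw [hB]; ring
  -- Coranks from `l` on also lie in the promise, but the sign of the weight there need not agree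
  -- with the problem, so they are charged as error.
  set S : Finset (Matrix (Fin n) (Fin n) 𝔽) :=
    Finset.univ.filter fun X => X.det = t ∨ (X.det = 0 ∧ n - X.rank = 1) with hSdef
  have hmem : ∀ X, X ∈ S ↔ X.det = t ∨ (X.det = 0 ∧ n - X.rank = 1) := by simp [hSdef]
  have hφt : ∀ X, X.det = t → ∃ c : ℝ, 0 ≤ c ∧ φ X = ((s : ℤ) : ℝ) * c := by
    intro X hX
    refine ⟨v 0 / (Finset.univ.filter fun Y : Matrix (Fin n) (Fin n) 𝔽 => Y.det = t).card,
      div_nonneg (by linarith) (Nat.cast_nonneg _), ?_⟩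
    rw [hφ, detRankWeight, if_pos hX, hw, mul_div_assoc]
  have hφ1 : ∀ X : Matrix (Fin n) (Fin n) 𝔽, X.det = 0 → n - X.rank = 1 →
      ∃ c : ℝ, 0 ≤ c ∧ φ X = -((s : ℤ) : ℝ) * c := by
    intro X hX hX1
    refine ⟨-v 1 / (Finset.univ.filter fun Y : Matrix (Fin n) (Fin n) 𝔽 => Y.rank = n - 1).card,
      div_nonneg (by linarith) (Nat.cast_nonneg _), ?_⟩
    rw [hφ, detRankWeight, hX, if_neg ht.symm, if_pos rfl, hX1, hw]
    ring
  have hmain := P.discrepancy_bound f hP φ (by simpa using hmom 0 (Nat.zero_le _)) hFT S (by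
    intro X hX
    rcases (hmem X).1 hX with h | ⟨h, h'⟩
    · obtain ⟨c, hc, hφc⟩ := hφt X h
      rw [hft X h, hφc]
      rcases Int.units_eq_one_or s with rfl | rfl
      · exact Or.inl ⟨rfl, by simpa using hc⟩
      · exact Or.inr ⟨rfl, by simpa using hc⟩
    · obtain ⟨c, hc, hφc⟩ := hφ1 X h h'
      rw [hf0 X h, hφc]
      rcases Int.units_eq_one_or s with rfl | rfl
      · exact Or.inr ⟨rfl, by simpa using hc⟩
      · exact Or.inl ⟨by simp, by simpa using hc⟩)
  have hR : ∑ X ∈ S, |φ X| = |v 0| + |v 1| := by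
    rw [hφ, sum_abs_detRankWeight hn0 ht w True (fun i => i = 1) S
      (fun X hX => by simp [hmem, hX]) (fun X hX => by simp [hmem, hX, ht.symm]), if_pos trivial,
      Finset.sum_ite_eq', if_pos (Finset.mem_Icc.2 ⟨le_rfl, hn0⟩)]
    simp only [hw, abs_mul, hsabs, one_mul]
  have hWS : ∑ X ∈ Sᶜ, |φ X| = ∑ i ∈ Finset.Icc l n, |v i| := by
    rw [hφ, sum_abs_detRankWeight hn0 ht w False (fun i => i ≠ 1) Sᶜ
      (fun X hX => by simp [hmem, hX]) (fun X hX => by simp [hmem, hX, ht.symm]), if_neg not_false,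
      hIcc _ fun i hi => by simp [hw, hvout i hi]]
    simp only [hw, abs_mul, hsabs, one_mul]
    rw [if_neg (by simp), zero_add, zero_add]
    refine Finset.sum_congr rfl fun i hi => if_pos ?_
    have := Finset.mem_Icc.1 hi
    omega
  rw [hR, hWS, abs_of_nonneg (by linarith), abs_of_nonpos (by linarith)] at hmain
  have hB0 : 0 ≤ B := by
    have : 0 ≤ ∑ i ∈ Finset.Icc l n, v i ^ 2 * q ^ (i ^ 2) :=
      Finset.sum_nonneg fun i _ => by positivity
    positivity
  -- `S` carries mass at least `2` and the rest at most `δ`, so the left side of `hmain` is at least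
  -- `2 * δ - δ`.
  have hfin : δ ≤ 2 * 4 ^ P.cost * √B := by nlinarith
  calc δ ^ 2 ≤ (2 * 4 ^ P.cost * √B) ^ 2 := by gcongr
    _ = 4 * 16 ^ P.cost * B := by
      rw [mul_pow, mul_pow, Real.sq_sqrt hB0, ← pow_mul, mul_comm P.cost, pow_mul]
      norm_num

/-- The lower bound for telling apart two nonzero values of the determinant. -/
theorem QuantumProtocol.nonsingular_bound
    (P : QuantumProtocol (Matrix (Fin n) (Fin n) 𝔽) (Matrix (Fin n) (Fin n) 𝔽)) (hn : 0 < n)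
    {a b : 𝔽} (hab : a ≠ b) (ha : a ≠ 0) (hb : b ≠ 0) (f : Matrix (Fin n) (Fin n) 𝔽 → Option ℤˣ)
    (hfa : ∀ X, X.det = a → f X = some (-1)) (hfb : ∀ X, X.det = b → f X = some 1) {δ : ℝ}
    (hδ : 0 ≤ δ) (hP : P.HasError (fun A B => f (A + B)) (1 / 2 - δ / 2)) :
    δ ^ 2 ≤ 4 * 16 ^ P.cost * (32 * (Fintype.card 𝔽 : ℝ) ^ 2 / (Fintype.card 𝔽 : ℝ) ^ (n ^ 2)) := by
  set q : ℝ := (Fintype.card 𝔽 : ℝ) with hqdef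
  have hq0 : 0 < q := by rw [hqdef]; exact_mod_cast Fintype.card_pos
  set Na : ℝ :=
    ((Finset.univ.filter fun X : Matrix (Fin n) (Fin n) 𝔽 => X.det = a).card : ℝ) with hNa
  set Nb : ℝ :=
    ((Finset.univ.filter fun X : Matrix (Fin n) (Fin n) 𝔽 => X.det = b).card : ℝ) with hNb
  have hNa0 : 0 < Na := card_det_eq_pos hn ha
  have hNb0 : 0 < Nb := card_det_eq_pos hn hb
  let φ : Matrix (Fin n) (Fin n) 𝔽 → ℝ := fun X =>
    if X.det = b then Nb⁻¹ else if X.det = a then -Na⁻¹ else 0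
  have hsum : ∀ g : ℝ → ℝ, g 0 = 0 → ∑ X, g (φ X) = Nb * g Nb⁻¹ + Na * g (-Na⁻¹) := by
    intro g hg
    have h : ∀ X, g (φ X) = (if X.det = b then g Nb⁻¹ else 0) +
        if X.det = a then g (-Na⁻¹) else 0 := by
      intro X
      simp only [φ]
      by_cases h1 : X.det = b
      · simp [h1, hab.symm]
      · by_cases h2 : X.det = a <;> simp [h1, h2, hg, hab]
    simp only [h, Finset.sum_add_distrib]
    simp only [← Finset.sum_filter, Finset.sum_const, nsmul_eq_mul, hNa, hNb]
  have hzero : ∑ X, φ X = 0 := by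
    refine (hsum id rfl).trans ?_
    simp only [id, mul_neg, mul_inv_cancel₀ hNa0.ne', mul_inv_cancel₀ hNb0.ne']
    norm_num
  have hsq : ∑ X, φ X ^ 2 ≤ 8 * q / q ^ (n ^ 2) := by
    rw [hsum (fun x => x ^ 2) (by norm_num)]
    have h1 := inv_card_det_eq_le hn ha
    have h2 := inv_card_det_eq_le hn hb
    rw [← hNa, ← hqdef] at h1
    rw [← hNb, ← hqdef] at h2
    calc _ = Nb⁻¹ + Na⁻¹ := by field_simp
      _ ≤ 4 * q / q ^ (n ^ 2) + 4 * q / q ^ (n ^ 2) := add_le_add h2 h1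
      _ = _ := by ring
  have hinv : IsSLInvariant (fun X : Matrix (Fin n) (Fin n) 𝔽 => (φ X : ℂ)) := by
    intro P Q X hP hQ
    have hdet : (P * X * Q).det = X.det := by simp [hP, hQ]
    simp only [φ, hdet]
  set B : ℝ := 32 * q ^ 2 / q ^ (n ^ 2) with hB
  have hFT : ∀ M, ‖matrixFourier (fun X => (φ X : ℂ)) M‖ ≤ √B := by
    intro M
    by_cases hM : M.rank ≤ n - 1
    · rw [hinv.matrixFourier_eq_zero (m := n - 1) (by omega) (fun j _ => ?_) M hM, norm_zero]
      · exact Real.sqrt_nonneg _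
      -- The weight lives on corank `0`, so every moment equals the total sum, which is zero. Thus
      -- all Fourier coefficients at singular matrices vanish.
      · have h0 : ∀ X : Matrix (Fin n) (Fin n) 𝔽, φ X * q ^ (j * (n - X.rank)) = φ X := by
          intro X
          by_cases hX : X.det = 0
          · simp [φ, hX, ha.symm, hb.symm]
          · have : ¬ X.rank < n := fun h => hX (Matrix.det_eq_zero_iff_rank_lt.2 h)
            rw [Nat.sub_eq_zero_of_le (by omega), mul_zero, pow_zero, mul_one]
        have h1 : ∑ X : Matrix (Fin n) (Fin n) 𝔽, φ X * q ^ (j * (n - X.rank)) = 0 := by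
          simp only [h0, hzero]
        have h2 := congrArg ((↑) : ℝ → ℂ) h1
        simpa only [hqdef, Complex.ofReal_sum, Complex.ofReal_mul, Complex.ofReal_pow,
          Complex.ofReal_natCast, Complex.ofReal_zero] using h2
    · refine Real.le_sqrt_of_sq_le ?_
      refine (hinv.norm_sq_matrixFourier_le (m := n - 1) (e := 1) one_pos (by omega)
        (by omega)).trans ?_
      simp only [Complex.norm_real, Real.norm_eq_abs, sq_abs]
      calc _ ≤ 4 * q ^ (1 ^ 2) * (8 * q / q ^ (n ^ 2)) := by gcongr
        _ = B := by rw [hB]; ring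
  set S : Finset (Matrix (Fin n) (Fin n) 𝔽) :=
    Finset.univ.filter fun X => X.det = b ∨ X.det = a with hSdef
  have hmem : ∀ X, X ∈ S ↔ X.det = b ∨ X.det = a := by simp [hSdef]
  have hmain := P.discrepancy_bound f hP φ hzero hFT S (by
    intro X hX
    rcases (hmem X).1 hX with h | h
    · exact Or.inl ⟨hfb X h, by simp only [φ, h, if_true]; positivity⟩
    · refine Or.inr ⟨hfa X h, ?_⟩
      simp only [φ, h, if_neg hab, if_true]
      have : 0 < Na⁻¹ := by positivity
      linarith)
  have hcompl : ∀ X ∈ Sᶜ, |φ X| = 0 := by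
    intro X hX
    rw [Finset.mem_compl, hmem, not_or] at hX
    simp only [φ, if_neg hX.1, if_neg hX.2, abs_zero]
  have hWS : ∑ X ∈ Sᶜ, |φ X| = 0 := Finset.sum_eq_zero hcompl
  have hR : ∑ X ∈ S, |φ X| = 2 := by
    have h1 := Finset.sum_add_sum_compl S fun X => |φ X|
    rw [hWS, add_zero] at h1
    rw [h1, hsum (fun x => |x|) abs_zero, abs_neg, abs_of_pos (by positivity),
      abs_of_pos (by positivity), mul_inv_cancel₀ hNa0.ne', mul_inv_cancel₀ hNb0.ne']
    norm_num
  rw [hR, hWS] at hmain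
  have hB0 : 0 ≤ B := by positivity
  have hfin : δ ≤ 2 * 4 ^ P.cost * √B := by linarith
  calc δ ^ 2 ≤ (2 * 4 ^ P.cost * √B) ^ 2 := by gcongr
    _ = 4 * 16 ^ P.cost * B := by
      rw [mul_pow, mul_pow, Real.sq_sqrt hB0, ← pow_mul, mul_comm P.cost, pow_mul]
      norm_num

end DetRankWeight

/-! ### Choice of parameters and the final bound. -/

section FinalBound

theorem pow_div_pow_le_rpow_neg {q : ℝ} (hq : 1 ≤ q) {a b : ℕ} {E : ℝ} (h : (a : ℝ) - b ≤ -E) :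
    q ^ a / q ^ b ≤ q ^ (-E) := by
  have hq0 : 0 < q := by linarith
  rw [← Real.rpow_natCast, ← Real.rpow_natCast, ← Real.rpow_sub hq0]
  exact Real.rpow_le_rpow_of_exponent_le hq h

theorem cost_lower_bound_of_sq_le {q : ℝ} (hq : 2 ≤ q) {n C : ℕ} (hC : 1 ≤ C) {B E : ℝ}
    (h : (1 / (2 * q ^ (((n : ℝ) - 1) / 3))) ^ 2 ≤ 4 * 16 ^ C * B) (hB : B ≤ 2 ^ 17 * q ^ (-E))
    (hE : (n : ℝ) ^ 2 / 300 ≤ E - 2 * ((n : ℝ) - 1) / 3) :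
    1 / 7500 * (n : ℝ) ^ 2 * Real.logb 2 q ≤ C := by
  have hq0 : 0 < q := by linarith
  have hq1 : 1 ≤ q := by linarith
  set y := q ^ (((n : ℝ) - 1) / 3) with hy
  have hy0 : 0 < y := Real.rpow_pos_of_pos hq0 _
  have hy2 : y ^ 2 = q ^ (2 * ((n : ℝ) - 1) / 3) := by
    rw [hy, ← Real.rpow_natCast, ← Real.rpow_mul hq0.le]
    congr 1
    push_cast
    ring
  have h1 : 1 ≤ 2 ^ 21 * 16 ^ C * (q ^ (-E) * y ^ 2) := by
    have h2 : 1 / (4 * y ^ 2) ≤ 4 * 16 ^ C * (2 ^ 17 * q ^ (-E)) := by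
      calc 1 / (4 * y ^ 2) = (1 / (2 * y)) ^ 2 := by ring
        _ ≤ 4 * 16 ^ C * B := h
        _ ≤ _ := by gcongr
    rw [div_le_iff₀ (by positivity)] at h2
    calc (1 : ℝ) ≤ _ := h2
      _ = _ := by ring
  have h2 : q ^ ((n : ℝ) ^ 2 / 300) ≤ 2 ^ (21 + 4 * C) := by
    have h3 : q ^ (-E) * y ^ 2 ≤ q ^ (-((n : ℝ) ^ 2 / 300)) := by
      rw [hy2, ← Real.rpow_add hq0]
      exact Real.rpow_le_rpow_of_exponent_le hq1 (by linarith)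
    have h4 : 1 ≤ 2 ^ 21 * 16 ^ C * q ^ (-((n : ℝ) ^ 2 / 300)) := by
      refine h1.trans ?_
      gcongr
    rw [Real.rpow_neg hq0.le, ← div_eq_mul_inv, le_div_iff₀ (Real.rpow_pos_of_pos hq0 _),
      one_mul] at h4
    refine h4.trans_eq ?_
    rw [pow_add, pow_mul]
    norm_num
  have h3 := Real.logb_le_logb_of_le (by norm_num : (1 : ℝ) < 2) (Real.rpow_pos_of_pos hq0 _) h2
  rw [Real.logb_rpow_eq_mul_logb_of_pos hq0, Real.logb_pow, Real.logb_self_eq_one (by norm_num)]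
    at h3
  push_cast at h3
  -- With `C ≥ 1`, `21 + 4 * C ≤ 25 * C`, and `25 * 300 = 7500`.
  have hC' : (1 : ℝ) ≤ C := by exact_mod_cast hC
  linarith

variable {𝔽 : Type*} [Field 𝔽] {n : ℕ}

theorem Matrix.exists_det_eq {R : Type*} [CommRing R] (hn : 0 < n) (a : R) :
    ∃ A : Matrix (Fin n) (Fin n) R, A.det = a := by
  refine ⟨Matrix.diagonal (Function.update 1 ⟨0, hn⟩ a), ?_⟩
  rw [Matrix.det_diagonal, Finset.prod_update_of_mem (Finset.mem_univ _)]
  simp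

theorem detProblem_eq_neg_one {a b : 𝔽} {A B : Matrix (Fin n) (Fin n) 𝔽} (h : (A + B).det = a) :
    detProblem n a b A B = some (-1) := by
  simp [detProblem, h]

theorem detProblem_eq_one {a b : 𝔽} (hab : a ≠ b) {A B : Matrix (Fin n) (Fin n) 𝔽}
    (h : (A + B).det = b) : detProblem n a b A B = some 1 := by
  simp [detProblem, h, hab.symm]

/-- Needed to absorb the additive constant in the cost estimate. Without communication the output
ignores one input, yet varying that input alone, with the other one zero, reaches both determinants.
-/
theorem QuantumProtocol.one_le_cost_of_hasError_detProblem (hn : 0 < n) {a b : 𝔽} (hab : a ≠ b)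
    (P : QuantumProtocol (Matrix (Fin n) (Fin n) 𝔽) (Matrix (Fin n) (Fin n) 𝔽)) {δ : ℝ}
    (hδ : 0 < δ) (hP : P.HasError (detProblem n a b) (1 / 2 - δ / 2)) : 1 ≤ P.cost := by
  rw [Nat.one_le_iff_ne_zero]
  intro h0
  obtain ⟨A, hA⟩ := Matrix.exists_det_eq hn a
  obtain ⟨B, hB⟩ := Matrix.exists_det_eq hn b
  rcases P.outputProb_eq_of_cost_eq_zero h0 1 with h | h
  · have h1 := hP 0 A (-1) (detProblem_eq_neg_one (by rw [zero_add, hA]))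
    have h2 := hP 0 B 1 (detProblem_eq_one hab (by rw [zero_add, hB]))
    have h3 := P.outputProb_add 0 A
    rw [h 0 A B] at h3
    linarith
  · have h1 := hP A 0 (-1) (detProblem_eq_neg_one (by rw [add_zero, hA]))
    have h2 := hP B 0 1 (detProblem_eq_one hab (by rw [add_zero, hB]))
    have h3 := P.outputProb_add A 0
    rw [h A B 0] at h3
    linarith

variable [Fintype 𝔽] [DecidableEq 𝔽]

theorem QuantumProtocol.singular_cost_bound
    (P : QuantumProtocol (Matrix (Fin n) (Fin n) 𝔽) (Matrix (Fin n) (Fin n) 𝔽)) (hn : 2 ≤ n)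
    (hC : 1 ≤ P.cost) {t : 𝔽} (ht : t ≠ 0) (f : Matrix (Fin n) (Fin n) 𝔽 → Option ℤˣ) (s : ℤˣ)
    (hft : ∀ X, X.det = t → f X = some s) (hf0 : ∀ X, X.det = 0 → f X = some (-s))
    (hP : P.HasError (fun A B => f (A + B))
      (1 / 2 - 1 / (2 * (Fintype.card 𝔽 : ℝ) ^ (((n : ℝ) - 1) / 3)) / 2)) :
    1 / 7500 * (n : ℝ) ^ 2 * Real.logb 2 (Fintype.card 𝔽) ≤ P.cost := by
  have hq : (2 : ℝ) ≤ Fintype.card 𝔽 := by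
    exact_mod_cast (Fintype.one_lt_card : 1 < Fintype.card 𝔽)
  have hn' : (2 : ℝ) ≤ n := by exact_mod_cast hn
  have hy0 : (0 : ℝ) < (Fintype.card 𝔽 : ℝ) ^ (((n : ℝ) - 1) / 3) :=
    Real.rpow_pos_of_pos (by linarith) _
  have hsing := fun l hl hln hW => P.singular_bound hn ht f s hft hf0
    (δ := 1 / (2 * (Fintype.card 𝔽 : ℝ) ^ (((n : ℝ) - 1) / 3))) (by positivity) hP (l := l)
    hl hln hW
  set q : ℝ := (Fintype.card 𝔽 : ℝ) with hqdef
  have hq0 : 0 < q := by linarith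
  have hq1 : 1 ≤ q := by linarith
  -- Below `200`, `l = n + 1` leaves only coranks `0` and `1`, with no tail. The exponent `2 * n -
  -- 2` is linear but suffices: `n ^ 2 / 300 ≤ 2 * n / 3 ≤ 4 * (n - 1) / 3` for `2 ≤ n ≤ 200`.
  rcases lt_or_ge n 200 with hsmall | hlarge
  · have hempty : Finset.Icc (n + 1) n = ∅ := Finset.Icc_eq_empty (by omega)
    have h := hsing (n + 1) (by omega) le_rfl
      (by rw [hempty, Finset.sum_empty]; positivity)
    refine cost_lower_bound_of_sq_le hq hC h (E := 2 * (n : ℝ) - 2) ?_ ?_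
    · rw [hempty, Finset.sum_empty, add_zero]
      have h1 : n + 1 - 2 = n - 1 := by omega
      rw [h1]
      calc _ = 512 * (q ^ ((n - 1) ^ 2 + 1) / q ^ (n ^ 2)) := by rw [pow_succ]; ring
        _ ≤ 2 ^ 17 * q ^ (-(2 * (n : ℝ) - 2)) := by
          refine mul_le_mul (by norm_num) (pow_div_pow_le_rpow_neg hq1 (le_of_eq ?_))
            (by positivity) (by positivity)
          rw [Nat.cast_add, Nat.cast_pow, Nat.cast_pow, Nat.cast_sub (by omega)]
          push_cast
          ring
    · have : (n : ℝ) ≤ 200 := by exact_mod_cast hsmall.le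
      nlinarith
  · have hn200 : (200 : ℝ) ≤ n := by exact_mod_cast hlarge
    -- The offset `10` gives `l ≥ (n - 1) / 3 + 9`, covering the tail constant `256 ≤ q ^ 8` and one
    -- more factor `q`. As `2 * n * l` is about `2 * n ^ 2 / 3`, an exponent of order `n ^ 2`
    -- survives.
    set l := n / 3 + 10 with hl
    have hl1 : (l : ℝ) ≤ (n : ℝ) / 3 + 10 := by
      rw [hl]
      push_cast
      have := Nat.cast_div_le (α := ℝ) (m := n) (n := 3)
      push_cast at this
      linarith
    have hl2 : ((n : ℝ) - 2) / 3 + 10 ≤ l := by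
      have h1 : n ≤ 3 * (n / 3) + 2 := by omega
      have h2 : (n : ℝ) ≤ 3 * ((n / 3 : ℕ) : ℝ) + 2 := by exact_mod_cast h1
      rw [hl]
      push_cast
      linarith
    have hln : l ≤ n := by omega
    have hW : 128 * (q * (q⁻¹) ^ l) ≤ 1 / (2 * q ^ (((n : ℝ) - 1) / 3)) := by
      rw [le_div_iff₀ (by positivity), inv_pow]
      have h1 : (256 : ℝ) ≤ q ^ (8 : ℝ) := by
        calc (256 : ℝ) = 2 ^ (8 : ℝ) := by norm_num
          _ ≤ q ^ (8 : ℝ) := Real.rpow_le_rpow (by norm_num) hq (by norm_num)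
      have h2 : 256 * q * q ^ (((n : ℝ) - 1) / 3) ≤ q ^ l := by
        calc 256 * q * q ^ (((n : ℝ) - 1) / 3) ≤
              q ^ (8 : ℝ) * q ^ (1 : ℝ) * q ^ (((n : ℝ) - 1) / 3) := by
              rw [Real.rpow_one]
              gcongr
          _ = q ^ ((8 : ℝ) + 1 + ((n : ℝ) - 1) / 3) := by
              rw [Real.rpow_add hq0, Real.rpow_add hq0]
          _ ≤ q ^ (l : ℝ) := Real.rpow_le_rpow_of_exponent_le hq1 (by linarith)
          _ = q ^ l := Real.rpow_natCast _ _
      have h3 : 0 < q ^ l := by positivity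
      calc _ = 256 * q * q ^ (((n : ℝ) - 1) / 3) / q ^ l := by ring
        _ ≤ 1 := (div_le_one h3).2 h2
    have h := hsing l (by omega) (by omega)
      ((sum_abs_lagrangeWeight_le hq (by omega)).trans hW)
    refine cost_lower_bound_of_sq_le hq hC h (E := (n : ℝ) ^ 2 / 5) ?_ ?_
    · have hsum : q ^ ((l - 2) ^ 2) * (∑ i ∈ Finset.Icc l n,
          lagrangeWeight q l n i ^ 2 * q ^ (i ^ 2)) ≤ 4096 * q ^ (n + 2 * n * l) := by
        have hcard : ((Finset.Icc l n).card : ℝ) ≤ q ^ n := by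
          have h1 : (Finset.Icc l n).card ≤ n := by rw [Nat.card_Icc]; omega
          calc ((Finset.Icc l n).card : ℝ) ≤ n := by exact_mod_cast h1
            _ ≤ 2 ^ n := by exact_mod_cast Nat.lt_two_pow_self.le
            _ ≤ q ^ n := by gcongr
        rw [Finset.mul_sum]
        calc _ ≤ ∑ i ∈ Finset.Icc l n, 4096 * q ^ (2 * n * l) := by
              refine Finset.sum_le_sum fun i hi => ?_
              refine le_trans ?_ (sq_lagrangeWeight_mul_le hq (by omega) hi)
              rw [mul_comm]
              gcongr
              omega
          _ = (Finset.Icc l n).card * (4096 * q ^ (2 * n * l)) := by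
              rw [Finset.sum_const, nsmul_eq_mul]
          _ ≤ q ^ n * (4096 * q ^ (2 * n * l)) := by gcongr
          _ = _ := by rw [pow_add]; ring
      have hfirst : q ^ ((l - 2) ^ 2) * q ≤ q ^ (n + 2 * n * l) := by
        rw [← pow_succ]
        refine pow_le_pow_right₀ hq1 ?_
        have h1 : (l - 2) ^ 2 ≤ l ^ 2 := Nat.pow_le_pow_left (by omega) 2
        nlinarith
      have hN : 0 < q ^ (n ^ 2) := by positivity
      calc _ = 16 * (32 * (q ^ ((l - 2) ^ 2) * q) + q ^ ((l - 2) ^ 2) * ∑ i ∈ Finset.Icc l n,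
              lagrangeWeight q l n i ^ 2 * q ^ (i ^ 2)) / q ^ (n ^ 2) := by ring
        _ ≤ 16 * (32 * q ^ (n + 2 * n * l) + 4096 * q ^ (n + 2 * n * l)) / q ^ (n ^ 2) := by
            gcongr
        _ = 66048 * (q ^ (n + 2 * n * l) / q ^ (n ^ 2)) := by ring
        _ ≤ 2 ^ 17 * q ^ (-((n : ℝ) ^ 2 / 5)) := by
            refine mul_le_mul (by norm_num) (pow_div_pow_le_rpow_neg hq1 ?_)
              (by positivity) (by positivity)
            push_cast
            nlinarith
    · nlinarith

theorem QuantumProtocol.detProblem_cost_bound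
    (P : QuantumProtocol (Matrix (Fin n) (Fin n) 𝔽) (Matrix (Fin n) (Fin n) 𝔽)) (hn : 2 ≤ n)
    {a b : 𝔽} (hab : a ≠ b) (hP : P.HasError (detProblem n a b)
      (1 / 2 - 1 / (4 * (Fintype.card 𝔽 : ℝ) ^ (((n : ℝ) - 1) / 3)))) :
    1 / 7500 * (n : ℝ) ^ 2 * Real.logb 2 (Fintype.card 𝔽) ≤ P.cost := by
  have hq : (2 : ℝ) ≤ Fintype.card 𝔽 := by
    exact_mod_cast (Fintype.one_lt_card : 1 < Fintype.card 𝔽)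
  have hn' : (2 : ℝ) ≤ n := by exact_mod_cast hn
  have hy0 : (0 : ℝ) < (Fintype.card 𝔽 : ℝ) ^ (((n : ℝ) - 1) / 3) :=
    Real.rpow_pos_of_pos (by linarith) _
  have hε : 1 / (4 * (Fintype.card 𝔽 : ℝ) ^ (((n : ℝ) - 1) / 3)) =
      1 / (2 * (Fintype.card 𝔽 : ℝ) ^ (((n : ℝ) - 1) / 3)) / 2 := by
    rw [div_div]
    ring_nf
  rw [hε] at hP
  have hC := P.one_le_cost_of_hasError_detProblem (by omega) hab (by positivity) hP
  set f : Matrix (Fin n) (Fin n) 𝔽 → Option ℤˣ := fun X => detProblem n a b 0 X with hf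
  have hfa : ∀ X, X.det = a → f X = some (-1) := fun X hX =>
    detProblem_eq_neg_one (by rw [zero_add, hX])
  have hfb : ∀ X, X.det = b → f X = some 1 := fun X hX =>
    detProblem_eq_one hab (by rw [zero_add, hX])
  have hP' : P.HasError (fun A B => f (A + B))
      (1 / 2 - 1 / (2 * (Fintype.card 𝔽 : ℝ) ^ (((n : ℝ) - 1) / 3)) / 2) := by
    have : (fun A B => f (A + B)) = detProblem n a b := by
      funext A B
      change detProblem n a b 0 (A + B) = detProblem n a b A B
      unfold detProblem
      rw [zero_add]
    rwa [this]
  by_cases ha : a = 0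
  · subst ha
    exact P.singular_cost_bound hn hC hab.symm f 1 hfb hfa hP'
  by_cases hb : b = 0
  · subst hb
    exact P.singular_cost_bound hn hC ha f (-1) hfa (by simpa using hfb) hP'
  have h := P.nonsingular_bound (by omega) hab ha hb f hfa hfb (by positivity) hP'
  refine cost_lower_bound_of_sq_le hq hC h (E := (n : ℝ) ^ 2 - 2) ?_ (by nlinarith)
  rw [mul_div_assoc]
  refine mul_le_mul (by norm_num) (pow_div_pow_le_rpow_neg (by linarith) (le_of_eq ?_))
    (by positivity) (by positivity)
  push_cast
  ring

end FinalBound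

theorem theorem1p6 :
    ∃ c : ℝ, 0 < c ∧
      ∀ (𝔽 : Type*) [Field 𝔽] [Fintype 𝔽] (a b : 𝔽), a ≠ b → ∀ n : ℕ, 2 ≤ n →
        ENNReal.ofReal (c * (n : ℝ) ^ 2 * Real.logb 2 (Fintype.card 𝔽)) ≤
          (quantumCC (1 / 2 - 1 / (4 * (Fintype.card 𝔽 : ℝ) ^ (((n : ℝ) - 1) / 3)))
            (detProblem n a b) : ENNReal) := by
  classical
  refine ⟨1 / 7500, by norm_num, fun 𝔽 _ _ a b hab n hn => ?_⟩
  set x := 1 / 7500 * (n : ℝ) ^ 2 * Real.logb 2 (Fintype.card 𝔽) with hx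
  -- Costs are integers, so the real bound passes through its ceiling into `ℕ∞`.
  have h : ((⌈x⌉₊ : ℕ) : ℕ∞) ≤
      quantumCC (1 / 2 - 1 / (4 * (Fintype.card 𝔽 : ℝ) ^ (((n : ℝ) - 1) / 3)))
        (detProblem n a b) :=
    le_iInf₂ fun P hP => Nat.cast_le.2 (Nat.ceil_le.2 (P.detProblem_cost_bound hn hab hP))
  calc ENNReal.ofReal x ≤ ENNReal.ofReal (⌈x⌉₊ : ℕ) := ENNReal.ofReal_le_ofReal (Nat.le_ceil x)
    _ = (((⌈x⌉₊ : ℕ) : ℕ∞) : ENNReal) := by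
      rw [ENNReal.ofReal_natCast]
      rfl
    _ ≤ _ := ENat.toENNReal_le.2 h
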